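/- Conventions. Subsets of $\mathbb N$ are identified with elements of Cantor space $2^{\mathbb N}$. A $\Pi^0_1$ class is a set $\mathcal P\subseteq 2^{\mathbb N}$ of the form $\{X : \forall n\; X\upharpoonright n\in R\}$ for a computable set $R$ of binary strings. A cost function is a computable function $\mathbf c:\mathbb N\times\mathbb N\to\{q\in\mathbb Q: q\ge 0\}$. It is monotonic if, for all $x,s$, $\mathbf c(x+1,s)\le \mathbf c(x,s)$, $\mathbf c(x,s)\le \mathbf c(x,s+1)$, and $\mathbf c(x,s)=0$ whenever $x>s$. It has the limit condition if $\lim_x\liminf_s \mathbf c(x,s)=0$, that is, for each $e$, for almost every $x$, there are infinitely many $s$ with $\mathbf c(x,s)\le 2^{-e}$. A computable approximation of a set $A$ is a computable sequence $(A_s)_{s\in\mathbb N}$ of finite sets (given by explicit lists of their elements) such that $\lim_s A_s(x)=A(x)$ for each $x$. For $s>0$ let $\mathbf c_s(A_s)=\mathbf c(x,s)$ where $x<s$ is least such that $A_{s-1}(x)\ne A_s(x)$, and $\mathbf c_s(A_s)=0$ if there is no such $x$. A set $A$ obeys $\mathbf c$ if some computable approximation $(A_s)$ of $A$ satisfies $\sum_{s>0}\mathbf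 c_s(A_s)<\infty$. Theorem. Let $\mathcal P$ be a nonempty $\Pi^0_1$ class, and let $\mathbf c$ be a monotonic cost function with the limit condition. Then there is a $\Delta^0_2$ set $Y\in\mathcal P$ such that each computably enumerable set $A\le_T Y$ obeys $\mathbf c$. -/

import Mathlib

open Filter
open scoped ENNReal NNRat

/-- A cost function: a computable function from pairs of natural numbers to the nonnegative
rationals. Computability means that the numerator and the denominator (in lowest terms) of
`c x s` are computable from `x` and `s`. -/
def IsCostFunction (c : ℕ → ℕ → ℚ≥0) : Prop :=
  Computable₂ (fun x s => (c x s).num) ∧ Computable₂ (fun x s => (c x s).den)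

/-- `c` is nonincreasing in the main argument. -/
def NonincreasingInMain (c : ℕ → ℕ → ℚ≥0) : Prop :=
  ∀ x s, c (x + 1) s ≤ c x s

/-- `c` is nondecreasing in the stage. -/
def NondecreasingInStage (c : ℕ → ℕ → ℚ≥0) : Prop :=
  (∀ x s, s < x → c x s = 0) ∧ ∀ x s, c x s ≤ c x (s + 1)

/-- `c` is monotonic. -/
def IsMonotonic (c : ℕ → ℕ → ℚ≥0) : Prop :=
  NonincreasingInMain c ∧ NondecreasingInStage c

/-- The limit condition `lim_x liminf_s c(x,s) = 0`: for each `e`, for almost every `x`, there are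
infinitely many `s` with `c(x,s) ≤ 2^{-e}`. -/
def LimitCondition (c : ℕ → ℕ → ℚ≥0) : Prop :=
  ∀ e : ℕ, ∀ᶠ x in atTop, ∃ᶠ s in atTop, c x s ≤ (2 ^ e)⁻¹

/-- A computable sequence of finite sets: from `s` one can compute an explicit list of the elements
of the `s`-th set. -/
def IsComputableSeq (As : ℕ → Finset ℕ) : Prop :=
  ∃ L : ℕ → List ℕ, Computable L ∧ ∀ s, As s = (L s).toFinset

/-- `As` is a computable approximation of `A`: a computable sequence of finite sets with
`lim_s As s (x) = A(x)` for each `x`. -/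
def IsComputableApprox (As : ℕ → Finset ℕ) (A : Set ℕ) : Prop :=
  IsComputableSeq As ∧ ∀ x, ∀ᶠ s in atTop, (x ∈ As s ↔ x ∈ A)

open Classical in
/-- The cost `c_s(A_s)` of changing `A_{s-1}` to `A_s`, for `s > 0`: the value `c(x,s)` where
`x < s` is least such that `A_{s-1}(x) ≠ A_s(x)`, and `0` if there is no such `x`. -/
noncomputable def changeCost (c : ℕ → ℕ → ℚ≥0) (As : ℕ → Finset ℕ) (s : ℕ) : ℚ≥0 :=
  if h : ∃ x, x < s ∧ ¬ (x ∈ As (s - 1) ↔ x ∈ As s) then c (Nat.find h) s else 0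

/-- The total cost `∑_{s > 0} c_s(A_s)`, a value in `[0,∞]`. -/
noncomputable def totalCost (c : ℕ → ℕ → ℚ≥0) (As : ℕ → Finset ℕ) : ℝ≥0∞ :=
  ∑' s : ℕ, ENNReal.ofReal (changeCost c As (s + 1) : ℝ)

/-- `A` obeys `c`: some computable approximation of `A` has finite total cost. -/
def Obeys (A : Set ℕ) (c : ℕ → ℕ → ℚ≥0) : Prop :=
  ∃ As : ℕ → Finset ℕ, IsComputableApprox As A ∧ totalCost c As < ∞

open Classical in
/-- The initial segment of length `n` of (the characteristic sequence of) `X`. -/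
noncomputable def initSeg (X : Set ℕ) (n : ℕ) : List Bool :=
  (List.range n).map fun i => decide (i ∈ X)

/-- `P` is a `Π⁰₁` class in Cantor space (whose elements are identified with sets of natural
numbers): there is a computable set `R` of binary strings such that `P` consists of the `X` all of
whose initial segments are in `R`. -/
def IsPi01Class (P : Set (Set ℕ)) : Prop :=
  ∃ R : List Bool → Prop, ComputablePred R ∧ ∀ X : Set ℕ, X ∈ P ↔ ∀ n, R (initSeg X n)

/-- `A` is `Σ⁰₂`. -/
def IsSigma02 (A : Set ℕ) : Prop :=
  ∃ R : ℕ × ℕ × ℕ → Prop, ComputablePred R ∧ ∀ n, n ∈ A ↔ ∃ x, ∀ y, R (n, x, y)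

/-- `A` is `Δ⁰₂`: both `A` and its complement are `Σ⁰₂`. -/
def IsDelta02 (A : Set ℕ) : Prop :=
  IsSigma02 A ∧ IsSigma02 Aᶜ

open Classical in
/-- The characteristic function of `A`. -/
noncomputable def charFun (A : Set ℕ) (n : ℕ) : ℕ :=
  if n ∈ A then 1 else 0

/-- Turing reducibility `A ≤_T B` between sets of natural numbers. -/
def SetTuringReducible (A B : Set ℕ) : Prop :=
  TuringReducible (fun n => Part.some (charFun A n)) (fun n => Part.some (charFun B n))

/-! The set `Y` is built by forcing with `Π⁰₁` classes, using only limit computable decisions, so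
that any c.e. set computed by `Y` is already determined by very few bits of `Y`. A condition
excludes the sets `Z` with `Φ_e^Z(x) = v`; the given class is itself coded as one such condition,
`base`. The limit condition gives a limit computable `b` such that only numbers below `b k` ever
cost more than `4⁻ᵏ`.

At step `k` there is a string of length `k` that is live for the current conditions. The strongest
requirement `e ≤ k` without a condition that can force `Φ_e^Z(x) ≠ A_e(x)` for some `x < b k`, while
keeping the string live, does so and cancels the weaker requirements; then one bit is added. This is
a finite injury argument. If nevertheless `Φ_e^Y = A_e`, then `e` was eventually never able to act.
Hence there is a class containing `Y` such that, for almost all `k` and all `x < b k`, every member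
extending the first `k` bits of `Y` computes `A_e(x)` correctly (`exists_delta02_forcing`).

This makes `A_e` obey `c`. Its enumeration is sped up: stage `s` waits for a string of length `s +
1` that looks extendible and whose prefixes of length `k` force the current values at the numbers
costing more than `4⁻ᵏ` (`exists_stages`). A change with cost in `(4⁻ᵏ, 4⁻ᵏ⁺¹]` is charged to the
prefix of length `k`. No string is charged twice, since otherwise it would force both the value 0
and the value 1, hence be dead (`DeadAt.of_two_values`). There are `2ᵏ` strings of length `k`, and
`∑ 2ᵏ · 4⁻ᵏ⁺¹` is finite (`totalCost_lt_top`). -/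

namespace CostBasis

open Encodable Nat.Partrec

/-! ### Conditions and live strings -/

/-- All binary strings of length `t`. -/
def strings : ℕ → List (List Bool)
  | 0 => [[]]
  | t + 1 => (strings t).map (List.cons false) ++ (strings t).map (List.cons true)

theorem mem_strings {t : ℕ} {τ : List Bool} : τ ∈ strings t ↔ τ.length = t := by
  induction t generalizing τ with
  | zero => simp [strings]
  | succ t ih =>
    rcases τ with _ | ⟨b, τ⟩
    · simp [strings]
    · cases b <;> simp [strings, ih]

theorem primrec_strings : Primrec strings := by
  have h : Primrec₂ (fun (_ : ℕ) (l : List (List Bool)) =>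
      l.map (List.cons false) ++ l.map (List.cons true)) := by
    refine Primrec.list_append.comp ?_ ?_
    · exact Primrec.list_map Primrec.snd
        (Primrec.list_cons.comp (Primrec.const false) Primrec.snd)
    · exact Primrec.list_map Primrec.snd
        (Primrec.list_cons.comp (Primrec.const true) Primrec.snd)
  refine (Primrec.nat_rec₁ [[]] h).of_eq fun n => ?_
  induction n with
  | zero => rfl
  | succ n ih => simp only [ih, strings]

/-- The code of the functional with index `e`. -/
def functionalCode (e : ℕ) : Code := Denumerable.ofNat Code e.unpair.2

/-- The code whose domain is the computably enumerable set with index `e`. -/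
def setCode (e : ℕ) : Code := Denumerable.ofNat Code e.unpair.1

/-- The condition `r = (e, x, v)` stands for `Φ_e^Z(x) ≠ v`. It is violated by the string `τ` if
`|τ|` steps of computation reveal `Φ_e(x) = v` on a prefix of `τ`. -/
def Violates (τ : List Bool) (r : ℕ × ℕ × ℕ) : Prop :=
  ∃ m < τ.length + 1,
    Code.evaln τ.length (functionalCode r.1) (encode (τ.take m, r.2.1)) = some r.2.2

/-- `τ` violates no condition in the list `p`. -/
def Good (p : List (ℕ × ℕ × ℕ)) (τ : List Bool) : Prop := ∀ r ∈ p, ¬ Violates τ r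

/-- All extensions of `σ` by `t` bits violate some condition in `p`. -/
def DeadAt (p : List (ℕ × ℕ × ℕ)) (σ : List Bool) (t : ℕ) : Prop :=
  ∀ ρ ∈ strings t, ¬ Good p (σ ++ ρ)

/-- `σ` has arbitrarily long extensions that violate no condition in `p`. -/
def Live (p : List (ℕ × ℕ × ℕ)) (σ : List Bool) : Prop := ∀ t, ¬ DeadAt p σ t

theorem primrec_functionalCode : Primrec functionalCode :=
  (Primrec.ofNat Code).comp (Primrec.snd.comp Primrec.unpair)

theorem primrec_setCode : Primrec setCode :=
  (Primrec.ofNat Code).comp (Primrec.fst.comp Primrec.unpair)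

theorem primrec_violates : PrimrecRel Violates := by
  have h : PrimrecRel (fun (m : ℕ) (a : List Bool × ℕ × ℕ × ℕ) =>
      Code.evaln a.1.length (functionalCode a.2.1) (encode (a.1.take m, a.2.2.1))
        = some a.2.2.2) := by
    have ha : Primrec (fun q : ℕ × List Bool × ℕ × ℕ × ℕ => q.2.1) :=
      Primrec.fst.comp Primrec.snd
    have hr : Primrec (fun q : ℕ × List Bool × ℕ × ℕ × ℕ => q.2.2) :=
      Primrec.snd.comp Primrec.snd
    refine Primrec.eq.comp (Code.primrec_evaln.comp (Primrec.pair (Primrec.pair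
      (Primrec.list_length.comp ha) (primrec_functionalCode.comp (Primrec.fst.comp hr)))
      (Primrec.encode.comp (Primrec.pair (Primrec.list_take.comp Primrec.fst ha)
        (Primrec.fst.comp (Primrec.snd.comp hr))))))
      (Primrec.option_some.comp (Primrec.snd.comp (Primrec.snd.comp hr)))
  refine PrimrecPred.of_eq (h.exists_mem_list.comp
    (f := fun a : List Bool × ℕ × ℕ × ℕ => List.range (a.1.length + 1)) (g := fun a => a)
    (Primrec.list_range.comp (Primrec.succ.comp (Primrec.list_length.comp Primrec.fst)))
    Primrec.id) fun a => ?_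
  simp [Violates]

theorem primrec_good : PrimrecRel Good := by
  have h : PrimrecRel (fun (r : ℕ × ℕ × ℕ) (τ : List Bool) => ¬ Violates τ r) :=
    (primrec_violates.swap).not
  exact h.forall_mem_list

theorem primrec_deadAt :
    PrimrecPred (fun a : (List (ℕ × ℕ × ℕ) × List Bool) × ℕ => DeadAt a.1.1 a.1.2 a.2) := by
  have h : PrimrecRel (fun (ρ : List Bool) (a : List (ℕ × ℕ × ℕ) × List Bool) =>
      ¬ Good a.1 (a.2 ++ ρ)) := by
    refine PrimrecRel.not ?_
    exact primrec_good.comp (Primrec.fst.comp Primrec.snd)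
      (Primrec.list_append.comp (Primrec.snd.comp Primrec.snd) Primrec.fst)
  exact h.forall_mem_list.comp (primrec_strings.comp Primrec.snd) Primrec.fst

theorem Violates.mono {τ τ' : List Bool} (h : τ <+: τ') {r : ℕ × ℕ × ℕ} (hv : Violates τ r) :
    Violates τ' r := by
  obtain ⟨m, hm, he⟩ := hv
  have hl := h.length_le
  refine ⟨m, by omega, ?_⟩
  have : τ'.take m = τ.take m := by
    obtain ⟨ρ, rfl⟩ := h
    rw [List.take_append_of_le_length (by omega)]
  rw [this]
  exact Code.evaln_mono hl he

theorem Good.of_prefix {p : List (ℕ × ℕ × ℕ)} {τ τ' : List Bool} (h : τ <+: τ')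
    (hg : Good p τ') : Good p τ :=
  fun r hr hv => hg r hr (hv.mono h)

theorem Good.of_subset {p q : List (ℕ × ℕ × ℕ)} {τ : List Bool} (h : p ⊆ q)
    (hg : Good q τ) : Good p τ :=
  fun r hr => hg r (h hr)

theorem DeadAt.mono {p : List (ℕ × ℕ × ℕ)} {σ : List Bool} {t t' : ℕ} (h : t ≤ t')
    (hd : DeadAt p σ t) : DeadAt p σ t' := by
  intro ρ hρ hg
  rw [mem_strings] at hρ
  refine hd (ρ.take t) (mem_strings.2 (by simp; omega)) (hg.of_prefix ?_)
  exact (List.prefix_append_right_inj σ).2 (List.take_prefix t ρ)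

theorem Live.good {p : List (ℕ × ℕ × ℕ)} {σ : List Bool} (h : Live p σ) : Good p σ := by
  by_contra hg
  refine h 0 fun ρ hρ => ?_
  rw [mem_strings, List.length_eq_zero_iff] at hρ
  simpa [hρ] using hg

/-- If both one-bit extensions die, at depths `t0` and `t1`, then `σ` dies at depth `max t0 t1 + 1`.
-/
theorem Live.exists_bit {p : List (ℕ × ℕ × ℕ)} {σ : List Bool} (h : Live p σ) :
    Live p (σ ++ [false]) ∨ Live p (σ ++ [true]) := by
  by_contra! hc
  obtain ⟨h0, h1⟩ := hc
  simp only [Live, not_forall, not_not] at h0 h1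
  obtain ⟨t0, h0⟩ := h0
  obtain ⟨t1, h1⟩ := h1
  refine h (max t0 t1 + 1) fun ρ hρ hg => ?_
  rw [mem_strings] at hρ
  rcases ρ with _ | ⟨b, ρ⟩
  · simp at hρ
  · have hl : ρ ∈ strings (max t0 t1) := mem_strings.2 (by simpa using hρ)
    have hs : σ ++ b :: ρ = (σ ++ [b]) ++ ρ := by simp
    rw [hs] at hg
    cases b
    · exact h0.mono (le_max_left _ _) ρ hl hg
    · exact h1.mono (le_max_right _ _) ρ hl hg

/-- The functional with index `e` gives at most one value on comparable strings. -/
def MonotoneFunctional (e : ℕ) : Prop :=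
  ∀ (τ τ' : List Bool) (x v : ℕ), τ <+: τ' → v ∈ (functionalCode e).eval (encode (τ, x)) →
    v ∈ (functionalCode e).eval (encode (τ', x))

theorem Violates.exists_eval {τ : List Bool} {r : ℕ × ℕ × ℕ} (h : Violates τ r) :
    ∃ m, r.2.2 ∈ (functionalCode r.1).eval (encode (τ.take m, r.2.1)) := by
  obtain ⟨m, -, he⟩ := h
  exact ⟨m, Code.evaln_sound he⟩

/-- Monotonicity lifts both computations from prefixes to `τ` itself, where the code has a single
value. -/
theorem Violates.value_unique {e x v w : ℕ} (he : MonotoneFunctional e) {τ : List Bool}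
    (hv : Violates τ (e, x, v)) (hw : Violates τ (e, x, w)) : v = w := by
  obtain ⟨m, hm⟩ := hv.exists_eval
  obtain ⟨n, hn⟩ := hw.exists_eval
  exact Part.mem_unique (he _ _ _ _ (List.take_prefix m τ) hm)
    (he _ _ _ _ (List.take_prefix n τ) hn)

/-- If all paths through `σ` that obey `p` compute both `v` and `w ≠ v`, then there are none. -/
theorem DeadAt.of_two_values {p : List (ℕ × ℕ × ℕ)} {σ : List Bool} {t e x v w : ℕ}
    (he : MonotoneFunctional e) (hvw : v ≠ w) (hv : DeadAt ((e, x, v) :: p) σ t)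
    (hw : DeadAt ((e, x, w) :: p) σ t) : DeadAt p σ t := by
  intro ρ hρ hg
  have key : ∀ u, DeadAt ((e, x, u) :: p) σ t → Violates (σ ++ ρ) (e, x, u) := by
    intro u hu
    by_contra hc
    refine hu ρ hρ fun r hr => ?_
    rcases List.mem_cons.1 hr with rfl | hr
    · exact hc
    · exact hg r hr
  exact hvw ((key v hv).value_unique he (key w hw))

/-! ### Initial segments -/

theorem length_initSeg (X : Set ℕ) (n : ℕ) : (initSeg X n).length = n := by simp [initSeg]

theorem initSeg_succ (X : Set ℕ) (n : ℕ) [Decidable (n ∈ X)] :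
    initSeg X (n + 1) = initSeg X n ++ [decide (n ∈ X)] := by
  simp only [initSeg, List.range_succ, List.map_append, List.map_cons, List.map_nil]
  congr

theorem initSeg_prefix (X : Set ℕ) {m n : ℕ} (h : m ≤ n) : initSeg X m <+: initSeg X n := by
  classical
  induction n, h using Nat.le_induction with
  | base => exact List.prefix_rfl
  | succ n _ ih => rw [initSeg_succ]; exact ih.trans (List.prefix_append _ _)

theorem take_initSeg (X : Set ℕ) {m n : ℕ} (h : m ≤ n) : (initSeg X n).take m = initSeg X m := by
  have := List.prefix_iff_eq_take.1 (initSeg_prefix X h)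
  rw [length_initSeg] at this
  exact this.symm

/-- `Z` satisfies all conditions in `p`. -/
def InClass (p : List (ℕ × ℕ × ℕ)) (Z : Set ℕ) : Prop := ∀ n, Good p (initSeg Z n)

theorem InClass.live {p : List (ℕ × ℕ × ℕ)} {Z : Set ℕ} (h : InClass p Z) (n : ℕ) :
    Live p (initSeg Z n) := by
  intro t hd
  obtain ⟨ρ, hρ⟩ := initSeg_prefix Z (Nat.le_add_right n t)
  have hl := congrArg List.length hρ
  simp only [List.length_append, length_initSeg] at hl
  exact hd ρ (mem_strings.2 (by omega)) (hρ ▸ h (n + t))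

/-- The step bound built into `Violates` is harmless along `Z`: a longer initial segment allows more
steps and still contains the prefix that was used. -/
theorem exists_violates_iff {Z : Set ℕ} {e x v : ℕ} :
    (∃ n, Violates (initSeg Z n) (e, x, v)) ↔
      ∃ n, v ∈ (functionalCode e).eval (encode (initSeg Z n, x)) := by
  constructor
  · rintro ⟨n, m, hm, he⟩
    rw [length_initSeg] at hm
    simp only [take_initSeg Z (Nat.le_of_lt_succ hm)] at he
    exact ⟨m, Code.evaln_sound he⟩
  · rintro ⟨n, hn⟩
    obtain ⟨k, hk⟩ := Code.evaln_complete.1 hn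
    refine ⟨max n k, n, ?_, ?_⟩
    · rw [length_initSeg]; omega
    · rw [length_initSeg, take_initSeg Z (le_max_left n k)]
      exact Code.evaln_mono (le_max_right n k) hk

/-! ### Limit computable functions -/

section LimitComputable

variable {α β γ : Type*} [Primcodable α] [Primcodable β] [Primcodable γ]

/-- `g` is the pointwise limit of a computable sequence of functions. -/
def LimitComputable (g : α → β) : Prop :=
  ∃ G : α → ℕ → β, Computable₂ G ∧ ∀ a, ∀ᶠ s in atTop, G a s = g a

theorem LimitComputable.of_computable {g : α → β} (h : Computable g) : LimitComputable g :=
  ⟨fun a _ => g a, h.comp Computable.fst, fun _ => Eventually.of_forall fun _ => rfl⟩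

theorem LimitComputable.of_primrec {g : α → β} (h : Primrec g) : LimitComputable g :=
  .of_computable h.to_comp

theorem LimitComputable.comp {g : β → γ} {f : α → β} (hg : LimitComputable g)
    (hf : LimitComputable f) : LimitComputable fun a => g (f a) := by
  obtain ⟨G, hG, hGl⟩ := hg
  obtain ⟨F, hF, hFl⟩ := hf
  refine ⟨fun a s => G (F a s) s, hG.comp hF Computable.snd, fun a => ?_⟩
  filter_upwards [hGl (f a), hFl a] with s h1 h2
  rw [h2, h1]

theorem LimitComputable.pair {f : α → β} {g : α → γ} (hf : LimitComputable f)
    (hg : LimitComputable g) : LimitComputable fun a => (f a, g a) := by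
  obtain ⟨F, hF, hFl⟩ := hf
  obtain ⟨G, hG, hGl⟩ := hg
  refine ⟨fun a s => (F a s, G a s), Computable.pair hF hG, fun a => ?_⟩
  filter_upwards [hGl a, hFl a] with s h1 h2
  rw [h2, h1]

theorem LimitComputable.cond {b : α → Bool} {f g : α → β} (hb : LimitComputable b)
    (hf : LimitComputable f) (hg : LimitComputable g) :
    LimitComputable fun a => bif b a then f a else g a := by
  have h : Computable fun q : Bool × β × β => bif q.1 then q.2.1 else q.2.2 :=
    Computable.cond Computable.fst (Computable.fst.comp Computable.snd)
      (Computable.snd.comp Computable.snd)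
  exact (LimitComputable.of_computable h).comp (hb.pair (hf.pair hg))

theorem LimitComputable.nat_rec {f : ℕ × β → β} (b : β) (hf : LimitComputable f) :
    LimitComputable fun n : ℕ => (Nat.rec b (fun k y => f (k, y)) n : β) := by
  obtain ⟨F, hF, hFl⟩ := hf
  refine ⟨fun n s => Nat.rec b (fun k y => F (k, y) s) n, ?_, fun n => ?_⟩
  · exact Computable.nat_rec Computable.fst (Computable.const b)
      (hF.comp Computable.snd (Computable.snd.comp Computable.fst)).to₂
  · induction n with
    | zero => exact Eventually.of_forall fun _ => rfl
    | succ n ih =>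
      filter_upwards [ih, hFl (n, (Nat.rec b (fun k y => f (k, y)) n : β))] with s h1 h2
      simp only [h1, h2]

open Classical in
-- This is how questions to the halting problem enter: the truth value of a `Σ⁰₁` statement is
-- guessed false until a witness appears, so the guess changes at most once.
theorem LimitComputable.of_monotone {q : α → ℕ → Prop}
    (hq : ComputablePred fun p : α × ℕ => q p.1 p.2)
    (hmono : ∀ a s t, s ≤ t → q a s → q a t) :
    LimitComputable fun a => decide (∃ t, q a t) := by
  refine ⟨fun a s => decide (q a s), hq.decide.to₂, fun a => ?_⟩
  by_cases h : ∃ t, q a t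
  · obtain ⟨t, ht⟩ := h
    filter_upwards [eventually_ge_atTop t] with s hs
    have : ∃ t, q a t := ⟨t, ht⟩
    simp [this, hmono a t s hs ht]
  · have : ∀ t, ¬ q a t := fun t ht => h ⟨t, ht⟩
    exact Eventually.of_forall fun s => by simp [this]

/-- With the approximation frozen at stage `s`, a counter starts at 0 and advances until a test
succeeds, for at most `s` rounds. Once the finitely many tests up to the true answer have settled
and `s` is at least that answer, the counter stops there. -/
theorem LimitComputable.find {P : α → ℕ → Bool} (hP : LimitComputable fun p : α × ℕ => P p.1 p.2)
    (hex : ∀ a, ∃ n, P a n = true) : LimitComputable fun a => Nat.find (hex a) := by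
  obtain ⟨G, hG, hGl⟩ := hP
  refine ⟨fun a s => Nat.rec 0 (fun _ u => bif G (a, u) s then u else u + 1) s, ?_, fun a => ?_⟩
  · have hu : Computable fun q : (α × ℕ) × ℕ × ℕ => q.2.2 := Computable.snd.comp Computable.snd
    exact Computable.nat_rec Computable.snd (Computable.const 0)
      (Computable.cond (hG.comp ((Computable.fst.comp Computable.fst).pair hu)
        (Computable.snd.comp Computable.fst)) hu (Computable.succ.comp hu)).to₂
  · set n := Nat.find (hex a) with hn
    have hev : ∀ᶠ s in atTop, ∀ m ≤ n, G (a, m) s = P a m :=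
      (Set.finite_Iic n).eventually_all.2 fun m _ => hGl (a, m)
    filter_upwards [hev, eventually_ge_atTop n] with s hs hns
    have key : ∀ i, (Nat.rec 0 (fun _ u => bif G (a, u) s then u else u + 1) i : ℕ) = min i n := by
      intro i
      induction i with
      | zero => simp
      | succ i ih =>
        simp only [ih, hs _ (min_le_right i n)]
        rcases lt_or_ge i n with h | h
        · have : P a i = false := by simpa using Nat.find_min (hex a) (hn ▸ h)
          rw [min_eq_left h.le, min_eq_left h, this, cond_false]
        · have : P a n = true := Nat.find_spec (hex a)
          rw [min_eq_right h, min_eq_right (by omega), this, cond_true]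
    rw [key, min_eq_right hns]

end LimitComputable

/-- The easy half of the limit lemma: the limit is `b` iff the approximation equals `b` from some
stage on. -/
theorem isDelta02_of_limitComputable {Y : Set ℕ} {g : ℕ → Bool} (hg : LimitComputable g)
    (hY : ∀ n, n ∈ Y ↔ g n = true) : IsDelta02 Y := by
  obtain ⟨G, hG, hGl⟩ := hg
  have hc : Computable fun q : ℕ × ℕ × ℕ => G q.1 (q.2.1 + q.2.2) :=
    hG.comp Computable.fst (Primrec.nat_add.to_comp.comp (Computable.fst.comp Computable.snd)
      (Computable.snd.comp Computable.snd))
  have key : ∀ (b : Bool) (n : ℕ), g n = b ↔ ∃ x, ∀ y, G n (x + y) = b := by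
    intro b n
    constructor
    · intro h
      obtain ⟨x, hx⟩ := eventually_atTop.1 (hGl n)
      exact ⟨x, fun y => (hx _ (Nat.le_add_right x y)).trans h⟩
    · rintro ⟨x, hx⟩
      obtain ⟨s, hs⟩ := eventually_atTop.1 (hGl n)
      rw [← hs (x + s) (Nat.le_add_left s x), hx]
  have hR : ∀ b, ComputablePred fun q : ℕ × ℕ × ℕ => G q.1 (q.2.1 + q.2.2) = b := fun b =>
    ⟨inferInstance, ((Primrec.eq.decide.to_comp).comp hc (Computable.const b))⟩
  refine ⟨⟨_, hR true, fun n => ?_⟩, ⟨_, hR false, fun n => ?_⟩⟩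
  · rw [hY, key]
  · rw [Set.mem_compl_iff, hY, Bool.not_eq_true, key]

/-! ### The construction below the halting problem -/

/-- `x` is enumerated into the computably enumerable set with index `e` within `t` steps. -/
def EnumeratedBy (e x t : ℕ) : Prop := ((setCode e).evaln t x).isSome = true

theorem EnumeratedBy.mono {e x s t : ℕ} (h : s ≤ t) (hs : EnumeratedBy e x s) :
    EnumeratedBy e x t := by
  unfold EnumeratedBy at *
  obtain ⟨v, hv⟩ := Option.isSome_iff_exists.1 hs
  exact Option.isSome_iff_exists.2 ⟨v, Code.evaln_mono h hv⟩

theorem primrec_enumeratedBy :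
    PrimrecPred fun q : (ℕ × ℕ) × ℕ => EnumeratedBy q.1.1 q.1.2 q.2 := by
  have h : Primrec fun q : (ℕ × ℕ) × ℕ => ((setCode q.1.1).evaln q.2 q.1.2).isSome :=
    Primrec.option_isSome.comp (Code.primrec_evaln.comp (Primrec.pair (Primrec.pair Primrec.snd
      (primrec_setCode.comp (Primrec.fst.comp Primrec.fst))) (Primrec.snd.comp Primrec.fst)))
  exact (Primrec.eq.comp h (Primrec.const true))

open Classical in
/-- The value at `x` of the characteristic function of the set with index `e`. -/
noncomputable def setValue (q : ℕ × ℕ) : ℕ :=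
  bif decide (∃ t, EnumeratedBy q.1 q.2 t) then 1 else 0

open Classical in
theorem limitComputable_setValue : LimitComputable setValue := by
  have h : LimitComputable fun q : ℕ × ℕ => decide (∃ t, EnumeratedBy q.1 q.2 t) :=
    LimitComputable.of_monotone (q := fun (q : ℕ × ℕ) t => EnumeratedBy q.1 q.2 t)
      primrec_enumeratedBy.computablePred fun _ _ _ => EnumeratedBy.mono
  exact h.cond (.of_primrec (Primrec.const 1)) (.of_primrec (Primrec.const 0))

open Classical in
/-- Whether the string `q.2` has no extension to a member of the class given by `q.1`. -/
noncomputable def isDead (q : List (ℕ × ℕ × ℕ) × List Bool) : Bool :=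
  decide (∃ t, DeadAt q.1 q.2 t)

theorem isDead_eq_true {p : List (ℕ × ℕ × ℕ)} {σ : List Bool} :
    isDead (p, σ) = true ↔ ∃ t, DeadAt p σ t := by
  simp [isDead]

theorem isDead_eq_false {p : List (ℕ × ℕ × ℕ)} {σ : List Bool} :
    isDead (p, σ) = false ↔ Live p σ := by
  simp [isDead, Live]

theorem limitComputable_isDead : LimitComputable isDead :=
  LimitComputable.of_monotone (q := fun (q : List (ℕ × ℕ × ℕ) × List Bool) t => DeadAt q.1 q.2 t)
    primrec_deadAt.computablePred
    fun _ _ _ h => DeadAt.mono h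

/-- The conditions in `f` that belong to requirements of index less than `e`. -/
def below (e : ℕ) (f : List (ℕ × ℕ × ℕ)) : List (ℕ × ℕ × ℕ) := f.filter fun r => r.1 < e

theorem primrec_below : Primrec fun q : ℕ × List (ℕ × ℕ × ℕ) => below q.1 q.2 := by
  have h : PrimrecRel fun (r : ℕ × ℕ × ℕ) (e : ℕ) => r.1 < e :=
    Primrec.nat_lt.comp (Primrec.fst.comp Primrec.fst) Primrec.snd
  exact (h.listFilter).comp Primrec.snd Primrec.fst

/-- The list of conditions after requirement `q.1.1` has acted with witness `q.1.2`: it discards the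
conditions of weaker requirements. -/
noncomputable def proposal (q : (ℕ × ℕ) × List (ℕ × ℕ × ℕ)) : List (ℕ × ℕ × ℕ) :=
  (q.1.1, q.1.2, setValue q.1) :: below q.1.1 q.2

theorem limitComputable_proposal : LimitComputable proposal := by
  have h1 : LimitComputable fun q : (ℕ × ℕ) × List (ℕ × ℕ × ℕ) => q.1.1 :=
    .of_primrec (Primrec.fst.comp Primrec.fst)
  have h2 : LimitComputable fun q : (ℕ × ℕ) × List (ℕ × ℕ × ℕ) => q.1.2 :=
    .of_primrec (Primrec.snd.comp Primrec.fst)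
  have h3 : LimitComputable fun q : (ℕ × ℕ) × List (ℕ × ℕ × ℕ) => setValue q.1 :=
    limitComputable_setValue.comp (.of_primrec Primrec.fst)
  have h4 : LimitComputable fun q : (ℕ × ℕ) × List (ℕ × ℕ × ℕ) => below q.1.1 q.2 :=
    (LimitComputable.of_primrec primrec_below).comp
      (h1.pair (.of_primrec Primrec.snd))
  exact (LimitComputable.of_primrec Primrec.list_cons).comp ((h1.pair (h2.pair h3)).pair h4)

/-- The requirement `e` has currently no condition in `f`. -/
def Fresh (f : List (ℕ × ℕ × ℕ)) (e : ℕ) : Prop := ∀ r ∈ f, r.1 ≠ e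

instance (f : List (ℕ × ℕ × ℕ)) (e : ℕ) : Decidable (Fresh f e) :=
  inferInstanceAs (Decidable (∀ r ∈ f, r.1 ≠ e))

theorem primrec_fresh : PrimrecRel Fresh := by
  have h : PrimrecRel fun (r : ℕ × ℕ × ℕ) (e : ℕ) => r.1 ≠ e :=
    PrimrecPred.not (Primrec.eq.comp (Primrec.fst.comp Primrec.fst) Primrec.snd)
  exact h.forall_mem_list

/-! ### The finite injury construction -/

section Construction

variable (base : ℕ × ℕ × ℕ) (b : ℕ → ℕ)

/-- The search at step `k` for a requirement that can act: a number `m < (k + 1) * b k` codes the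
requirement `m / b k` and the witness `m % b k`. -/
noncomputable def searchTest (a : ℕ × List (ℕ × ℕ × ℕ) × List Bool) (m : ℕ) : Bool :=
  -- The first alternative is a sentinel that makes the search total. `base` is kept outside the
  -- list of conditions, so that it is never discarded.
  decide ((a.1 + 1) * b a.1 ≤ m) || (decide (Fresh a.2.1 (m / b a.1)) &&
    !isDead (proposal ((m / b a.1, m % b a.1), a.2.1) ++ [base], a.2.2))

theorem exists_searchTest (a : ℕ × List (ℕ × ℕ × ℕ) × List Bool) :
    ∃ m, searchTest base b a m = true :=
  ⟨(a.1 + 1) * b a.1, by simp [searchTest]⟩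

/-- The least number at which the search stops. -/
noncomputable def search (a : ℕ × List (ℕ × ℕ × ℕ) × List Bool) : ℕ :=
  Nat.find (exists_searchTest base b a)

/-- The list of conditions after step `k`. -/
noncomputable def nextConds (a : ℕ × List (ℕ × ℕ × ℕ) × List Bool) : List (ℕ × ℕ × ℕ) :=
  bif decide (search base b a < (a.1 + 1) * b a.1) then
    proposal ((search base b a / b a.1, search base b a % b a.1), a.2.1) else a.2.1

/-- Step `k` of the construction. -/
noncomputable def step (a : ℕ × List (ℕ × ℕ × ℕ) × List Bool) : List (ℕ × ℕ × ℕ) × List Bool :=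
  (nextConds base b a, a.2.2 ++ [isDead (nextConds base b a ++ [base], a.2.2 ++ [false])])

/-- The list of conditions and the string before step `k` of the construction. -/
noncomputable def state (k : ℕ) : List (ℕ × ℕ × ℕ) × List Bool :=
  Nat.rec ([], []) (fun k y => step base b (k, y)) k

variable {base b}

theorem limitComputable_search (hb : LimitComputable b) : LimitComputable (search base b) := by
  refine LimitComputable.find ?_ (exists_searchTest base b)
  have hm : LimitComputable fun p : (ℕ × List (ℕ × ℕ × ℕ) × List Bool) × ℕ => p.2 :=
    .of_primrec Primrec.snd
  have hf : LimitComputable fun p : (ℕ × List (ℕ × ℕ × ℕ) × List Bool) × ℕ => p.1.2.1 :=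
    .of_primrec (Primrec.fst.comp (Primrec.snd.comp Primrec.fst))
  have hσ : LimitComputable fun p : (ℕ × List (ℕ × ℕ × ℕ) × List Bool) × ℕ => p.1.2.2 :=
    .of_primrec (Primrec.snd.comp (Primrec.snd.comp Primrec.fst))
  have hk : LimitComputable fun p : (ℕ × List (ℕ × ℕ × ℕ) × List Bool) × ℕ => p.1.1 :=
    .of_primrec (Primrec.fst.comp Primrec.fst)
  have hX := hb.comp hk
  have hdiv := (LimitComputable.of_primrec Primrec.nat_div).comp (hm.pair hX)
  have hmod := (LimitComputable.of_primrec Primrec.nat_mod).comp (hm.pair hX)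
  have h1 : LimitComputable fun p : (ℕ × List (ℕ × ℕ × ℕ) × List Bool) × ℕ =>
      decide ((p.1.1 + 1) * b p.1.1 ≤ p.2) := by
    have h : Primrec fun q : (ℕ × ℕ) × ℕ => decide ((q.1.1 + 1) * q.1.2 ≤ q.2) :=
      (Primrec.nat_le.comp (Primrec.nat_mul.comp
        (Primrec.succ.comp (Primrec.fst.comp Primrec.fst)) (Primrec.snd.comp Primrec.fst))
        Primrec.snd).decide
    exact (LimitComputable.of_primrec h).comp ((hk.pair hX).pair hm)
  have h2 : LimitComputable fun p : (ℕ × List (ℕ × ℕ × ℕ) × List Bool) × ℕ =>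
      decide (Fresh p.1.2.1 (p.2 / b p.1.1)) :=
    (LimitComputable.of_primrec primrec_fresh.decide).comp (hf.pair hdiv)
  have h3 := limitComputable_isDead.comp (((LimitComputable.of_primrec
    (Primrec.list_concat.comp Primrec.id (Primrec.const base))).comp
      (limitComputable_proposal.comp ((hdiv.pair hmod).pair hf))).pair hσ)
  have hc : Primrec fun q : Bool × Bool × Bool => (q.1 || (q.2.1 && !q.2.2)) :=
    Primrec.dom_finite _
  exact (LimitComputable.of_primrec hc).comp (h1.pair (h2.pair h3))

theorem limitComputable_nextConds (hb : LimitComputable b) :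
    LimitComputable (nextConds base b) := by
  have hf : LimitComputable fun p : ℕ × List (ℕ × ℕ × ℕ) × List Bool => p.2.1 :=
    .of_primrec (Primrec.fst.comp Primrec.snd)
  have hk : LimitComputable fun p : ℕ × List (ℕ × ℕ × ℕ) × List Bool => p.1 :=
    .of_primrec Primrec.fst
  have hX := hb.comp hk
  have hm := limitComputable_search (base := base) hb
  have hdiv := (LimitComputable.of_primrec Primrec.nat_div).comp (hm.pair hX)
  have hmod := (LimitComputable.of_primrec Primrec.nat_mod).comp (hm.pair hX)
  refine LimitComputable.cond ?_ (limitComputable_proposal.comp ((hdiv.pair hmod).pair hf)) hf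
  have h : Primrec fun q : (ℕ × ℕ) × ℕ => decide (q.2 < (q.1.1 + 1) * q.1.2) :=
    (Primrec.nat_lt.comp Primrec.snd (Primrec.nat_mul.comp
      (Primrec.succ.comp (Primrec.fst.comp Primrec.fst)) (Primrec.snd.comp Primrec.fst))).decide
  exact (LimitComputable.of_primrec h).comp ((hk.pair hX).pair hm)

theorem limitComputable_state (hb : LimitComputable b) : LimitComputable (state base b) := by
  refine LimitComputable.nat_rec (f := step base b) ([], []) ?_
  have hf := limitComputable_nextConds (base := base) hb
  have hσ : LimitComputable fun p : ℕ × List (ℕ × ℕ × ℕ) × List Bool => p.2.2 :=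
    .of_primrec (Primrec.snd.comp Primrec.snd)
  have hbit := limitComputable_isDead.comp (((LimitComputable.of_primrec
    (Primrec.list_concat.comp Primrec.id (Primrec.const base))).comp hf).pair
      ((LimitComputable.of_primrec
        (Primrec.list_concat.comp Primrec.id (Primrec.const false))).comp hσ))
  exact hf.pair ((LimitComputable.of_primrec Primrec.list_concat).comp (hσ.pair hbit))

/-- Since `m = e * b k + x` orders pairs by `e` first, the least successful `m` belongs to the
strongest requirement that can act. -/
theorem nextConds_spec (k : ℕ) (f : List (ℕ × ℕ × ℕ)) (σ : List Bool) :
    (nextConds base b (k, f, σ) = f ∧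
      ∀ e ≤ k, ∀ x < b k, Fresh f e → ¬ Live (proposal ((e, x), f) ++ [base]) σ) ∨
    ∃ e x, nextConds base b (k, f, σ) = proposal ((e, x), f) ∧ Fresh f e ∧
      Live (proposal ((e, x), f) ++ [base]) σ ∧
      ∀ e' ≤ k, e' < e → ∀ x < b k, Fresh f e' → ¬ Live (proposal ((e', x), f) ++ [base]) σ := by
  have hspec : searchTest base b (k, f, σ) (search base b (k, f, σ)) = true :=
    Nat.find_spec (exists_searchTest base b (k, f, σ))
  have hmin : ∀ e ≤ k, ∀ x < b k, e * b k + x < search base b (k, f, σ) → Fresh f e →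
      ¬ Live (proposal ((e, x), f) ++ [base]) σ := by
    intro e he x hx hlt hfr hl
    refine Nat.find_min (exists_searchTest base b (k, f, σ)) hlt ?_
    have h1 : (e * b k + x) / b k = e := by
      rw [mul_comm, Nat.mul_add_div (by omega), Nat.div_eq_of_lt hx, add_zero]
    have h2 : (e * b k + x) % b k = x := by
      rw [mul_comm, Nat.mul_add_mod, Nat.mod_eq_of_lt hx]
    simp [searchTest, h1, h2, hfr, isDead_eq_false.2 hl]
  by_cases h : search base b (k, f, σ) < (k + 1) * b k
  · right
    refine ⟨search base b (k, f, σ) / b k, search base b (k, f, σ) % b k, ?_, ?_⟩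
    · simp [nextConds, h]
    · simp only [searchTest, not_le.2 h, decide_false, Bool.false_or, Bool.and_eq_true,
        decide_eq_true_eq, Bool.not_eq_true'] at hspec
      refine ⟨hspec.1, isDead_eq_false.1 hspec.2, fun e' he' hlt x hx => hmin e' he' x hx ?_⟩
      calc e' * b k + x < (e' + 1) * b k := by rw [add_mul]; omega
        _ ≤ search base b (k, f, σ) / b k * b k := Nat.mul_le_mul_right _ hlt
        _ ≤ _ := Nat.div_mul_le_self _ _
  · left
    refine ⟨by simp [nextConds, h], fun e he x hx => hmin e he x hx ?_⟩
    calc e * b k + x < (e + 1) * b k := by rw [add_mul]; omega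
      _ ≤ (k + 1) * b k := Nat.mul_le_mul_right _ (by omega)
      _ ≤ _ := not_lt.1 h

theorem state_succ (k : ℕ) : state base b (k + 1) =
    (nextConds base b (k, (state base b k).1, (state base b k).2), (state base b k).2 ++
      [isDead (nextConds base b (k, (state base b k).1, (state base b k).2) ++ [base],
        (state base b k).2 ++ [false])]) := rfl

theorem length_state (k : ℕ) : (state base b k).2.length = k := by
  induction k with
  | zero => rfl
  | succ k ih => simp [state_succ, ih]

/-- A requirement acts only if the string stays live, and the bit 1 is chosen only if the extension
by 0 is dead, in which case `Live.exists_bit` applies. -/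
theorem live_state (h0 : Live [base] []) (k : ℕ) :
    Live ((state base b k).1 ++ [base]) (state base b k).2 := by
  induction k with
  | zero => exact h0
  | succ k ih =>
    set f := (state base b k).1
    set σ := (state base b k).2
    have hl : Live (nextConds base b (k, f, σ) ++ [base]) σ := by
      rcases nextConds_spec (base := base) (b := b) k f σ with ⟨h, -⟩ | ⟨e, x, h, -, hl, -⟩
      · rwa [h]
      · rwa [h]
    rw [state_succ]
    cases hd : isDead (nextConds base b (k, f, σ) ++ [base], σ ++ [false])
    · exact isDead_eq_false.1 hd
    · obtain ⟨t, ht⟩ := isDead_eq_true.1 hd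
      exact hl.exists_bit.resolve_left fun h => h t ht

theorem setValue_of_mem_state (k : ℕ) :
    ∀ r ∈ (state base b k).1, r.2.2 = setValue (r.1, r.2.1) := by
  induction k with
  | zero => intro r hr; simp [state] at hr
  | succ k ih =>
    intro r hr
    rw [state_succ] at hr
    rcases nextConds_spec (base := base) (b := b) k (state base b k).1 (state base b k).2 with
      ⟨h, -⟩ | ⟨e, x, h, -⟩
    · rw [h] at hr
      exact ih r hr
    · rw [h] at hr
      rcases List.mem_cons.1 hr with rfl | hr
      · rfl
      · exact ih r (List.mem_of_mem_filter hr)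

theorem mem_below {e : ℕ} {f : List (ℕ × ℕ × ℕ)} {r : ℕ × ℕ × ℕ} :
    r ∈ below e f ↔ r ∈ f ∧ r.1 < e := by
  simp [below]

theorem below_below {e e' : ℕ} (h : e ≤ e') (f : List (ℕ × ℕ × ℕ)) :
    below e (below e' f) = below e f := by
  simp only [below, List.filter_filter]
  refine List.filter_congr fun r _ => ?_
  by_cases hr : r.1 < e
  · simp [hr, hr.trans_le h]
  · simp [hr]

theorem below_succ_of_fresh {e : ℕ} {f : List (ℕ × ℕ × ℕ)} (h : Fresh f e) :
    below (e + 1) f = below e f := by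
  refine List.filter_congr fun r hr => ?_
  have := h r hr
  simp only [decide_eq_decide]
  omega

/-- The conditions of the strongest `e` requirements change at most when one of these
requirements acts. -/
theorem below_nextConds {e k : ℕ} {f : List (ℕ × ℕ × ℕ)} {σ : List Bool}
    (h : below e (nextConds base b (k, f, σ)) = below e f) :
    (below (e + 1) (nextConds base b (k, f, σ)) = below (e + 1) f) ∨
      (Fresh f e ∧ ¬ Fresh (nextConds base b (k, f, σ)) e) := by
  rcases nextConds_spec (base := base) (b := b) k f σ with ⟨h', -⟩ | ⟨e₀, x, h', hfr, -⟩
  · exact Or.inl (by rw [h'])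
  · rw [h'] at h ⊢
    rcases lt_trichotomy e₀ e with hlt | rfl | hgt
    -- If a stronger requirement acted, its new condition would lie in the unchanged part, so that
    -- requirement would not have been fresh.
    · exfalso
      have hm : (e₀, x, setValue (e₀, x)) ∈ below e (proposal ((e₀, x), f)) :=
        mem_below.2 ⟨List.mem_cons_self, hlt⟩
      rw [h, mem_below] at hm
      exact hfr _ hm.1 rfl
    · exact Or.inr ⟨hfr, fun hn => hn _ List.mem_cons_self rfl⟩
    · left
      have : below (e + 1) (proposal ((e₀, x), f)) = below (e + 1) (below e₀ f) := by
        exact List.filter_cons_of_neg (by simp only [decide_eq_true_eq]; omega)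
      rw [this, below_below hgt]

/-- Finite injury: once the stronger requirements have settled, requirement `e` can only pass from
having no condition to having one, and it then keeps that condition. -/
theorem exists_below_eq (e : ℕ) :
    ∃ k₀ p, ∀ k ≥ k₀, below e (state base b k).1 = p := by
  induction e with
  | zero => exact ⟨0, [], fun k _ => by simp [below]⟩
  | succ e ih =>
    obtain ⟨k₀, p, hp⟩ := ih
    have hstep : ∀ k ≥ k₀, (below (e + 1) (state base b (k + 1)).1 =
        below (e + 1) (state base b k).1) ∨ (Fresh (state base b k).1 e ∧
          ¬ Fresh (state base b (k + 1)).1 e) := fun k hk =>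
      below_nextConds ((hp (k + 1) (by omega)).trans (hp k hk).symm)
    have hiff : ∀ k, Fresh (state base b k).1 e ↔
        ∀ r ∈ below (e + 1) (state base b k).1, r.1 ≠ e := by
      refine fun k => ⟨fun h r hr => h r (mem_below.1 hr).1, fun h r hr hre => ?_⟩
      exact h r (mem_below.2 ⟨hr, by omega⟩) hre
    by_cases hfr : ∀ k ≥ k₀, Fresh (state base b k).1 e
    · exact ⟨k₀, p, fun k hk => by rw [below_succ_of_fresh (hfr k hk), hp k hk]⟩
    · push Not at hfr
      obtain ⟨k₁, hk₁, hn⟩ := hfr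
      refine ⟨k₁, below (e + 1) (state base b k₁).1, fun k hk => ?_⟩
      induction k, hk using Nat.le_induction with
      | base => rfl
      | succ k hk ih =>
        rcases hstep k (by omega) with h | ⟨h, -⟩
        · rw [h, ih]
        · exact absurd ((hiff k₁).2 (ih ▸ (hiff k).1 h)) hn

variable (base b)

/-- The set whose initial segments are the strings of the construction. -/
def limitSet : Set ℕ := {n | (state base b (n + 1)).2.getD n false = true}

variable {base b}

theorem initSeg_limitSet (k : ℕ) : initSeg (limitSet base b) k = (state base b k).2 := by
  classical
  induction k with
  | zero => rfl
  | succ k ih =>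
    rw [initSeg_succ, ih, state_succ]
    congr 2
    have : ∀ v, ((state base b k).2 ++ [v]).getD k false = v := by
      intro v
      rw [List.getD_append_right _ _ _ _ (by rw [length_state]), length_state]
      simp
    simp only [limitSet, Set.mem_ofPred_eq, state_succ, this, Bool.decide_eq_true]

/-- Let `b` be limit computable. Some `Δ⁰₂` member of a nonempty class has the following
property: if its image under the functional `e` is the set with index `e`, then it belongs to a
class such that, for almost all `k`, all members of the class sharing its first `k` bits have
the same image up to `b k`. -/
theorem exists_delta02_forcing (hb : LimitComputable b) (h0 : Live [base] []) :
    ∃ Y : Set ℕ, IsDelta02 Y ∧ InClass [base] Y ∧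
      ∀ e, (∀ x, ∃ n, setValue (e, x) ∈ (functionalCode e).eval (encode (initSeg Y n, x))) →
        ∃ p k₀, InClass p Y ∧ ∀ k ≥ k₀, ∀ x < b k,
          ∃ t, DeadAt ((e, x, setValue (e, x)) :: p) (initSeg Y k) t := by
  have hin : ∀ p k₀, (∀ k ≥ k₀, p ⊆ (state base b k).1 ++ [base]) →
      InClass p (limitSet base b) := by
    intro p k₀ hp n
    refine Good.of_prefix (initSeg_prefix _ (le_max_left n k₀)) ?_
    rw [initSeg_limitSet]
    exact (live_state h0 _).good.of_subset (hp _ (le_max_right n k₀))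
  refine ⟨limitSet base b, ?_, hin [base] 0 (by simp), fun e he => ?_⟩
  · refine isDelta02_of_limitComputable (g := fun n => (state base b (n + 1)).2.getD n false) ?_
      fun n => Iff.rfl
    exact (LimitComputable.of_primrec (Primrec.list_getD false)).comp
      (((LimitComputable.of_primrec Primrec.snd).comp ((limitComputable_state hb).comp
        (.of_primrec Primrec.succ))).pair (.of_primrec Primrec.id))
  obtain ⟨k₀, p, hp⟩ := exists_below_eq (base := base) (b := b) (e + 1)
  have hsub : ∀ k ≥ k₀, p ⊆ (state base b k).1 ++ [base] := fun k hk r hr =>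
    List.mem_append_left _ (mem_below.1 ((hp k hk).symm ▸ hr)).1
  have hcls := hin p k₀ hsub
  -- A condition held by `e` after stabilization is permanent, so `Y` satisfies it, and `Φ_e^Y`
  -- disagrees with the set at its witness. This contradicts `he`.
  have hfr : ∀ k ≥ k₀, Fresh (state base b k).1 e := by
    rintro k hk ⟨e', x, v⟩ hr rfl
    have hv : v = setValue (e', x) := setValue_of_mem_state k _ hr
    obtain ⟨n, hn⟩ := exists_violates_iff.2 (he x)
    have hm : (e', x, v) ∈ p := hp k hk ▸ mem_below.2 ⟨hr, by simp⟩
    exact hcls n _ hm (hv ▸ hn)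
  have hpe : ∀ k ≥ k₀, below e (state base b k).1 = p := fun k hk => by
    rw [← below_succ_of_fresh (hfr k hk), hp k hk]
  refine ⟨p ++ [base], max k₀ e, hin _ k₀ fun k hk => ?_, fun k hk x hx => ?_⟩
  · exact List.append_subset.2 ⟨hsub k hk, by simp⟩
  have hk0 : k₀ ≤ k := le_trans (le_max_left _ _) hk
  have hke : e ≤ k := le_trans (le_max_right _ _) hk
  -- Neither `e` nor a stronger requirement acts any more. So either none acts or a weaker one does,
  -- and in both cases `e` itself was unable to act with any `x < b k`.
  have hnl : ¬ Live (proposal ((e, x), (state base b k).1) ++ [base]) (state base b k).2 := by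
    rcases nextConds_spec (base := base) (b := b) k (state base b k).1 (state base b k).2 with
      ⟨-, h⟩ | ⟨e₀, x₀, h, hf₀, -, hmin⟩
    · exact h e hke x hx (hfr k hk0)
    · rcases lt_trichotomy e₀ e with hlt | rfl | hgt
      · exfalso
        have hm : (e₀, x₀, setValue (e₀, x₀)) ∈ below e (state base b (k + 1)).1 := by
          rw [state_succ, h]
          exact mem_below.2 ⟨List.mem_cons_self, hlt⟩
        rw [hpe (k + 1) (by omega), ← hpe k hk0] at hm
        exact hf₀ _ (mem_below.1 hm).1 rfl
      · exfalso
        refine hfr (k + 1) (by omega) (e₀, x₀, setValue (e₀, x₀)) ?_ rfl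
        rw [state_succ, h]
        exact List.mem_cons_self
      · exact hmin e hke hgt x hx (hfr k hk0)
  rw [initSeg_limitSet]
  simp only [Live, not_forall, not_not] at hnl
  obtain ⟨t, ht⟩ := hnl
  refine ⟨t, ?_⟩
  rw [← hpe k hk0]
  exact ht

end Construction

/-! ### The use principle -/

/-- `F` is a partial recursive functional, monotone in the oracle string, that computes `f` from
`Y`. -/
structure Computes (Y : Set ℕ) (F : List Bool × ℕ →. ℕ) (f : ℕ →. ℕ) : Prop where
  partrec : Partrec F
  mono : ∀ {τ τ' x v}, τ <+: τ' → v ∈ F (τ, x) → v ∈ F (τ', x)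
  complete : ∀ {x v}, v ∈ f x → ∃ n, v ∈ F (initSeg Y n, x)

theorem Computes.mono_initSeg {Y : Set ℕ} {F : List Bool × ℕ →. ℕ} {f : ℕ →. ℕ}
    (h : Computes Y F f) {m n x v : ℕ} (hmn : m ≤ n) (hv : v ∈ F (initSeg Y m, x)) :
    v ∈ F (initSeg Y n, x) :=
  h.mono (initSeg_prefix Y hmn) hv

theorem computes_of_partrec (Y : Set ℕ) {f : ℕ →. ℕ} (hf : Nat.Partrec f) :
    Computes Y (fun q => f q.2) f where
  partrec := (Partrec.nat_iff.2 hf).comp Computable.snd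
  mono _ h := h
  complete h := ⟨0, h⟩

/-- An oracle query beyond the end of the string diverges, which is what makes this monotone. -/
theorem computes_oracle (Y : Set ℕ) :
    Computes Y (fun q => ((q.1[q.2]?.map fun b : Bool => bif b then 1 else 0 : Option ℕ) : Part ℕ))
      (fun n => Part.some (charFun Y n)) where
  partrec := by
    refine Computable.ofOption ?_
    exact Computable.option_map (Computable.list_getElem?.comp Computable.fst Computable.snd)
      ((Primrec.dom_bool fun b : Bool => (bif b then 1 else 0 : ℕ)).to_comp.comp
        Computable.snd).to₂
  mono := by
    rintro τ τ' x v ⟨ρ, rfl⟩ h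
    simp only [Part.mem_coe, Option.mem_def, Option.map_eq_some_iff] at h ⊢
    obtain ⟨b, hb, rfl⟩ := h
    exact ⟨b, by rw [List.getElem?_append_left (List.getElem?_eq_some_iff.1 hb).1, hb], rfl⟩
  complete := by
    classical
    intro x v h
    rw [Part.mem_some_iff] at h
    refine ⟨x + 1, ?_⟩
    rw [h, initSeg_succ]
    by_cases hx : x ∈ Y <;> simp [length_initSeg, charFun, hx]

theorem Computes.pair {Y : Set ℕ} {F H : List Bool × ℕ →. ℕ} {f h : ℕ →. ℕ}
    (hF : Computes Y F f) (hH : Computes Y H h) :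
    Computes Y (fun q => (F q).bind fun a => (H q).bind fun b => Part.some (Nat.pair a b))
      (fun n => Nat.pair <$> f n <*> h n) where
  partrec := by
    have h1 : Partrec₂ fun (p : (List Bool × ℕ) × ℕ) (b : ℕ) => Part.some (Nat.pair p.2 b) :=
      (Primrec₂.natPair.to_comp.comp (Computable.snd.comp Computable.fst) Computable.snd).partrec
    have h2 : Partrec₂ fun (q : List Bool × ℕ) (a : ℕ) =>
        (H q).bind fun b => Part.some (Nat.pair a b) :=
      (hH.partrec.comp (Computable.fst : Computable (Prod.fst : (List Bool × ℕ) × ℕ → _))).bind h1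
    exact hF.partrec.bind h2
  mono hτ hv := by
    simp only [Part.mem_bind_iff] at hv ⊢
    obtain ⟨a, ha, b, hb, hv⟩ := hv
    exact ⟨a, hF.mono hτ ha, b, hH.mono hτ hb, hv⟩
  complete hv := by
    simp only [Seq.seq, Part.map_eq_map, Part.mem_bind_iff, Part.mem_map_iff] at hv
    obtain ⟨_, ⟨a, ha, rfl⟩, b, hb, rfl⟩ := hv
    obtain ⟨m, hm⟩ := hF.complete ha
    obtain ⟨n, hn⟩ := hH.complete hb
    refine ⟨max m n, ?_⟩
    simp only [Part.mem_bind_iff, Part.mem_some_iff]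
    exact ⟨a, hF.mono_initSeg (le_max_left _ _) hm, b, hH.mono_initSeg (le_max_right _ _) hn, rfl⟩

theorem Computes.comp {Y : Set ℕ} {F H : List Bool × ℕ →. ℕ} {f h : ℕ →. ℕ}
    (hF : Computes Y F f) (hH : Computes Y H h) :
    Computes Y (fun q => (H q).bind fun a => F (q.1, a)) (fun n => h n >>= f) where
  partrec := hH.partrec.bind
    (hF.partrec.comp ((Computable.fst.comp Computable.fst).pair Computable.snd)).to₂
  mono hτ hv := by
    obtain ⟨a, ha, hv⟩ := Part.mem_bind_iff.1 hv
    exact Part.mem_bind_iff.2 ⟨a, hH.mono hτ ha, hF.mono hτ hv⟩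
  complete hv := by
    obtain ⟨a, ha, hv⟩ := Part.mem_bind_iff.1 hv
    obtain ⟨m, hm⟩ := hH.complete ha
    obtain ⟨n, hn⟩ := hF.complete hv
    refine ⟨max m n, ?_⟩
    exact Part.mem_bind_iff.2
      ⟨a, hH.mono_initSeg (le_max_left _ _) hm, hF.mono_initSeg (le_max_right _ _) hn⟩

theorem Computes.prec {Y : Set ℕ} {F H : List Bool × ℕ →. ℕ} {f h : ℕ →. ℕ}
    (hF : Computes Y F f) (hH : Computes Y H h) :
    Computes Y (fun q => (Nat.rec (F (q.1, q.2.unpair.1)) (fun y IH => IH.bind fun i =>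
        H (q.1, Nat.pair q.2.unpair.1 (Nat.pair y i))) q.2.unpair.2 : Part ℕ))
      (fun p => let (a, n) := Nat.unpair p
        n.rec (f a) fun y IH => do
          let i ← IH
          h (Nat.pair a (Nat.pair y i))) where
  partrec := by
    have ha : Computable fun q : List Bool × ℕ => q.2.unpair.1 :=
      Computable.fst.comp (Computable.unpair.comp Computable.snd)
    have h1 : Partrec fun p : ((List Bool × ℕ) × ℕ × ℕ) =>
        H (p.1.1, Nat.pair p.1.2.unpair.1 (Nat.pair p.2.1 p.2.2)) :=
      hH.partrec.comp ((Computable.fst.comp Computable.fst).pair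
        (Primrec₂.natPair.to_comp.comp (ha.comp Computable.fst)
          (Primrec₂.natPair.to_comp.comp (Computable.fst.comp Computable.snd)
            (Computable.snd.comp Computable.snd))))
    exact Partrec.nat_rec (h := fun (q : List Bool × ℕ) (p : ℕ × ℕ) =>
        H (q.1, Nat.pair q.2.unpair.1 (Nat.pair p.1 p.2)))
      (Computable.snd.comp (Computable.unpair.comp Computable.snd))
      (hF.partrec.comp (Computable.fst.pair ha)) h1
  mono {τ τ' x v} hτ hv := by
    dsimp only at hv ⊢
    generalize x.unpair.2 = n at hv ⊢
    induction n generalizing v with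
    | zero => exact hF.mono hτ hv
    | succ n ih =>
      simp only [Part.mem_bind_iff] at hv ⊢
      obtain ⟨i, hi, hv⟩ := hv
      exact ⟨i, ih hi, hH.mono hτ hv⟩
  complete {x v} hv := by
    dsimp only at hv ⊢
    generalize x.unpair.2 = n at hv ⊢
    induction n generalizing v with
    | zero => exact hF.complete hv
    | succ y ih =>
      simp only [Part.bind_eq_bind, Part.mem_bind_iff] at hv ⊢
      obtain ⟨i, hi, hv⟩ := hv
      obtain ⟨m, hm⟩ := ih hi
      obtain ⟨n, hn⟩ := hH.complete hv
      refine ⟨max m n, i, ?_, hH.mono_initSeg (le_max_right _ _) hn⟩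
      -- It remains to lift the computation of the first `y` rounds from `m` to `max m n` bits; this
      -- is monotonicity, again by induction on `y`.
      clear hn hv hi ih
      have hτ := initSeg_prefix Y (le_max_left m n)
      induction y generalizing i with
      | zero => exact hF.mono hτ hm
      | succ y ih =>
        simp only [Part.mem_bind_iff] at hm ⊢
        obtain ⟨j, hj, hm⟩ := hm
        exact ⟨j, ih j hj, hH.mono hτ hm⟩

theorem Computes.rfind {Y : Set ℕ} {F : List Bool × ℕ →. ℕ} {f : ℕ →. ℕ}
    (hF : Computes Y F f) :
    Computes Y (fun q => Nat.rfind fun n =>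
        (F (q.1, Nat.pair q.2 n)).map fun m => decide (m = 0))
      (fun a => Nat.rfind fun n => (fun m => decide (m = 0)) <$> f (Nat.pair a n)) where
  partrec := by
    have h1 : Partrec fun p : (List Bool × ℕ) × ℕ => F (p.1.1, Nat.pair p.1.2 p.2) :=
      hF.partrec.comp ((Computable.fst.comp Computable.fst).pair
        (Primrec₂.natPair.to_comp.comp (Computable.snd.comp Computable.fst) Computable.snd))
    have h2 : Primrec fun m : ℕ => decide (m = 0) :=
      (Primrec.eq.comp Primrec.id (Primrec.const 0)).decide
    have h3 : Partrec₂ fun (q : List Bool × ℕ) (n : ℕ) =>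
        (F (q.1, Nat.pair q.2 n)).map fun m => decide (m = 0) :=
      h1.map (h2.to_comp.comp Computable.snd).to₂
    exact Partrec.rfind h3
  mono hτ hv := by
    obtain ⟨h1, h2⟩ := Nat.mem_rfind.1 hv
    refine Nat.mem_rfind.2 ⟨?_, fun hm => ?_⟩
    · obtain ⟨a, ha, ha0⟩ := (Part.mem_map_iff _).1 h1
      exact (Part.mem_map_iff _).2 ⟨a, hF.mono hτ ha, ha0⟩
    · obtain ⟨a, ha, ha0⟩ := (Part.mem_map_iff _).1 (h2 hm)
      exact (Part.mem_map_iff _).2 ⟨a, hF.mono hτ ha, ha0⟩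
  complete {x v} hv := by
    obtain ⟨h1, h2⟩ := Nat.mem_rfind.1 hv
    have hall : ∀ u ≤ v, ∃ n, ∀ m < u, ∃ a ∈ F (initSeg Y n, Nat.pair x m),
        decide (a = 0) = false := by
      intro u hu
      induction u with
      | zero => exact ⟨0, fun m hm => absurd hm (Nat.not_lt_zero m)⟩
      | succ u ih =>
        obtain ⟨n, hn⟩ := ih (by omega)
        obtain ⟨a, ha, ha0⟩ := (Part.mem_map_iff _).1 (h2 (Nat.lt_of_succ_le hu))
        obtain ⟨n', hn'⟩ := hF.complete ha
        refine ⟨max n n', fun m hm => ?_⟩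
        rcases Nat.lt_succ_iff_lt_or_eq.1 hm with hm | rfl
        · obtain ⟨a, ha, ha0⟩ := hn m hm
          exact ⟨a, hF.mono_initSeg (le_max_left _ _) ha, ha0⟩
        · exact ⟨a, hF.mono_initSeg (le_max_right _ _) hn', ha0⟩
    obtain ⟨n, hn⟩ := hall v le_rfl
    obtain ⟨a, ha, ha0⟩ := (Part.mem_map_iff _).1 h1
    obtain ⟨n', hn'⟩ := hF.complete ha
    refine ⟨max n n', Nat.mem_rfind.2 ⟨?_, fun {m} hm => ?_⟩⟩
    · exact (Part.mem_map_iff _).2 ⟨a, hF.mono_initSeg (le_max_right _ _) hn', ha0⟩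
    · obtain ⟨a, ha, ha0⟩ := hn m hm
      exact (Part.mem_map_iff _).2 ⟨a, hF.mono_initSeg (le_max_left _ _) ha, ha0⟩

/-- The use principle, by induction on the generation of `f`: a halting computation combines
finitely many subcomputations, and the maximum of their uses suffices. -/
theorem exists_computes {Y : Set ℕ} {f : ℕ →. ℕ}
    (hf : Nat.RecursiveIn {fun n => Part.some (charFun Y n)} f) : ∃ F, Computes Y F f := by
  induction hf with
  | zero => exact ⟨_, computes_of_partrec Y Nat.Partrec.zero⟩
  | succ => exact ⟨_, computes_of_partrec Y Nat.Partrec.succ⟩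
  | left => exact ⟨_, computes_of_partrec Y Nat.Partrec.left⟩
  | right => exact ⟨_, computes_of_partrec Y Nat.Partrec.right⟩
  | oracle g hg =>
    obtain rfl : g = fun n => Part.some (charFun Y n) := hg
    exact ⟨_, computes_oracle Y⟩
  | pair _ _ ihf ihh => exact ⟨_, ihf.choose_spec.pair ihh.choose_spec⟩
  | comp _ _ ihf ihh => exact ⟨_, ihf.choose_spec.comp ihh.choose_spec⟩
  | prec _ _ ihf ihh => exact ⟨_, ihf.choose_spec.prec ihh.choose_spec⟩
  | rfind _ ihf => exact ⟨_, ihf.choose_spec.rfind⟩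

theorem exists_functionalCode {Y A : Set ℕ} (h : SetTuringReducible A Y) :
    ∃ d : Code, (∀ (τ τ' : List Bool) (x v : ℕ), τ <+: τ' → v ∈ d.eval (encode (τ, x)) →
        v ∈ d.eval (encode (τ', x))) ∧
      ∀ x, ∃ n, charFun A x ∈ d.eval (encode (initSeg Y n, x)) := by
  obtain ⟨F, hF⟩ := exists_computes (RecursiveIn.iff_nat.1 h)
  obtain ⟨d, hd⟩ := Code.exists_code.1 hF.partrec
  have hev : ∀ τ x, d.eval (encode (τ, x)) = F (τ, x) := by
    intro τ x
    rw [hd]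
    simp [Part.map_id']
  refine ⟨d, fun τ τ' x v hτ hv => ?_, fun x => ?_⟩
  · rw [hev] at hv ⊢
    exact hF.mono hτ hv
  · obtain ⟨n, hn⟩ := hF.complete (Part.mem_some (charFun A x))
    exact ⟨n, by rwa [hev]⟩

theorem exists_setCode {A : Set ℕ} (h : REPred fun n => n ∈ A) :
    ∃ d : Code, ∀ x, x ∈ A ↔ (d.eval x).Dom := by
  obtain ⟨d, hd⟩ := Code.exists_code.1 (Partrec.nat_iff.1
    (Partrec.map h (Computable.const 0).to₂ : Partrec fun n => _))
  refine ⟨d, fun x => ?_⟩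
  rw [hd]
  simp [Part.assert]

/-- A computably enumerable set that is Turing reducible to `Y` has an index `e` such that the
functional with index `e` is monotone and computes the set with index `e` from `Y`. -/
theorem exists_index {Y A : Set ℕ} (hA : REPred fun n => n ∈ A) (h : SetTuringReducible A Y) :
    ∃ e, MonotoneFunctional e ∧ (∀ x, x ∈ A ↔ ∃ t, EnumeratedBy e x t) ∧
      ∀ x, ∃ n, setValue (e, x) ∈ (functionalCode e).eval (encode (initSeg Y n, x)) := by
  obtain ⟨d, hd⟩ := exists_setCode hA
  obtain ⟨d', hmono, hd'⟩ := exists_functionalCode h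
  have hf : functionalCode (Nat.pair (encode d) (encode d')) = d' := by simp [functionalCode]
  have hs : setCode (Nat.pair (encode d) (encode d')) = d := by simp [setCode]
  have hmem : ∀ x, x ∈ A ↔ ∃ t, EnumeratedBy (Nat.pair (encode d) (encode d')) x t := by
    intro x
    simp only [hd, EnumeratedBy, hs, Part.dom_iff_mem, Code.evaln_complete,
      Option.isSome_iff_exists, Option.mem_def]
    exact exists_comm
  refine ⟨Nat.pair (encode d) (encode d'), ?_, hmem, fun x => ?_⟩
  · rw [MonotoneFunctional, hf]
    exact hmono
  · rw [hf]
    convert! hd' x using 3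
    by_cases hx : x ∈ A
    · have := (hmem x).1 hx
      simp [setValue, charFun, hx, this]
    · have := (hmem x).not.1 hx
      simp [setValue, charFun, hx, this]

/-- Take a functional that outputs 1 exactly on the strings outside `R`. To lie in `P` is to avoid
the value 1. -/
theorem exists_base {P : Set (Set ℕ)} (hP : IsPi01Class P) :
    ∃ base, ∀ Z, Z ∈ P ↔ InClass [base] Z := by
  obtain ⟨R, hR, hRP⟩ := hP
  have hF : Partrec fun q : List Bool × ℕ =>
      (Part.assert (¬ R q.1) fun _ => Part.some 1 : Part ℕ) :=
    (Partrec.map (hR.not.to_re.comp Computable.fst : Partrec fun q : List Bool × ℕ => _)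
      (Computable.const 1).to₂).of_eq fun q => by
        ext; simp [eq_comm]
  obtain ⟨d, hd⟩ := Code.exists_code.1 hF
  have hev : ∀ (τ : List Bool) (x : ℕ), d.eval (encode (τ, x)) =
      Part.assert (¬ R τ) fun _ => Part.some 1 := by
    intro τ x
    rw [hd]
    simp [Part.map_id']
  have hf : functionalCode (Nat.pair 0 (encode d)) = d := by simp [functionalCode]
  refine ⟨(Nat.pair 0 (encode d), 0, 1), fun Z => ?_⟩
  have := exists_violates_iff (Z := Z) (e := Nat.pair 0 (encode d)) (x := 0) (v := 1)
  rw [hf] at this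
  simp only [hev] at this
  rw [hRP, ← not_iff_not]
  simp only [InClass, Good, List.mem_singleton, forall_eq, not_forall, not_not, this]
  simp

/-! ### Cost functions -/

/-- The cost of `x` at stage `s` is greater than `4⁻ᵏ`. -/
def Exceeds (c : ℕ → ℕ → ℚ≥0) (k x s : ℕ) : Prop := (4 ^ k)⁻¹ < c x s

theorem computablePred_exceeds {c : ℕ → ℕ → ℚ≥0} (hc : IsCostFunction c) :
    ComputablePred fun q : (ℕ × ℕ) × ℕ => Exceeds c q.1.1 q.1.2 q.2 := by
  have hpow : Primrec fun k : ℕ => 4 ^ k := by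
    refine (Primrec.nat_rec₁ 1 (Primrec.nat_mul.comp₂ (Primrec₂.const 4)
      Primrec₂.right)).of_eq fun k => ?_
    induction k with
    | zero => rfl
    | succ k ih => rw [pow_succ', ← ih]
  have hx : Computable fun q : (ℕ × ℕ) × ℕ => q.1.2 := Computable.snd.comp Computable.fst
  have h : Computable fun q : (ℕ × ℕ) × ℕ =>
      decide ((c q.1.2 q.2).den < 4 ^ q.1.1 * (c q.1.2 q.2).num) :=
    Primrec.nat_lt.decide.to_comp.comp (hc.2.comp hx Computable.snd)
      (Primrec.nat_mul.to_comp.comp (hpow.to_comp.comp (Computable.fst.comp Computable.fst))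
        (hc.1.comp hx Computable.snd))
  refine h.computablePred.of_eq fun q => ?_
  have hd : (0 : ℚ≥0) < (c q.1.2 q.2).den := by exact_mod_cast (c q.1.2 q.2).den_pos
  rw [Exceeds]
  nth_rewrite 3 [← NNRat.num_div_den (c q.1.2 q.2)]
  rw [inv_lt_iff_one_lt_mul₀ (by positivity), div_mul_eq_mul_div, mul_comm, one_lt_div hd]
  norm_cast

theorem cost_mono {c : ℕ → ℕ → ℚ≥0} (h : NondecreasingInStage c) (x : ℕ)
    {s t : ℕ} (hst : s ≤ t) : c x s ≤ c x t :=
  monotone_nat_of_le_succ (h.2 x) hst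

theorem cost_anti {c : ℕ → ℕ → ℚ≥0} (h : NonincreasingInMain c) (s : ℕ)
    {x y : ℕ} (hxy : x ≤ y) : c y s ≤ c x s :=
  antitone_nat_of_succ_le (f := fun x => c x s) (fun x => h x s) hxy

theorem exists_not_exceeds {c : ℕ → ℕ → ℚ≥0} (hmon : IsMonotonic c) (hlim : LimitCondition c)
    (k : ℕ) : ∃ x, ¬ ∃ s, Exceeds c k x s := by
  -- Here `2^(2k) = 4^k`; as the cost is nondecreasing in the stage, infinitely many small values
  -- bound all of them.
  obtain ⟨x, hx⟩ := (hlim (2 * k)).exists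
  refine ⟨x, fun ⟨s, hs⟩ => ?_⟩
  obtain ⟨t, hst, ht⟩ := frequently_atTop.1 hx s
  rw [pow_mul] at ht
  norm_num at ht
  exact absurd ((cost_mono hmon.2 x hst).trans ht) (not_le.2 hs)

/-- There is a limit computable bound, for each `k`, on the numbers whose cost ever exceeds
`4⁻ᵏ`. -/
theorem exists_limitComputable_bound {c : ℕ → ℕ → ℚ≥0} (hc : IsCostFunction c)
    (hmon : IsMonotonic c) (hlim : LimitCondition c) :
    ∃ b : ℕ → ℕ, LimitComputable b ∧ ∀ k x s, Exceeds c k x s → x < b k := by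
  classical
  have h1 : LimitComputable fun q : ℕ × ℕ => decide (∃ s, Exceeds c q.1 q.2 s) :=
    LimitComputable.of_monotone (q := fun (q : ℕ × ℕ) s => Exceeds c q.1 q.2 s)
      (computablePred_exceeds hc) fun q s t hst hs => lt_of_lt_of_le hs (cost_mono hmon.2 q.2 hst)
  have h2 : LimitComputable fun q : ℕ × ℕ => !decide (∃ s, Exceeds c q.1 q.2 s) :=
    (LimitComputable.of_primrec Primrec.not).comp h1
  have hex : ∀ k, ∃ x, (!decide (∃ s, Exceeds c k x s)) = true := fun k => by
    obtain ⟨x, hx⟩ := exists_not_exceeds hmon hlim k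
    exact ⟨x, by simpa using hx⟩
  obtain ⟨b, hb, hspec⟩ : ∃ b, LimitComputable b ∧
      ∀ k, (!decide (∃ s, Exceeds c k (b k) s)) = true :=
    ⟨_, LimitComputable.find (P := fun k x => !decide (∃ s, Exceeds c k x s)) h2 hex,
      fun k => @Nat.find_spec _ _ (hex k)⟩
  refine ⟨b, hb, fun k x s hs => ?_⟩
  by_contra hx
  simp only [Bool.not_eq_true', decide_eq_false_iff_not] at hspec
  exact hspec k ⟨s, lt_of_lt_of_le hs (cost_anti hmon.1 s (not_lt.1 hx))⟩

/-! ### The speeded-up enumeration -/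

open Classical in
/-- The value at `x` of the characteristic function of the `t`-th approximation to the set with
index `e`. -/
noncomputable def stageValue (e x t : ℕ) : ℕ := bif decide (EnumeratedBy e x t) then 1 else 0

theorem primrec_stageValue (e : ℕ) : Primrec₂ (stageValue e) := by
  classical
  have h : Primrec fun q : ℕ × ℕ => decide (EnumeratedBy e q.1 q.2) :=
    (primrec_enumeratedBy.comp (f := fun q : ℕ × ℕ => ((e, q.1), q.2)) (Primrec.pair
      (Primrec.pair (Primrec.const e) Primrec.fst) Primrec.snd)).decide
  exact Primrec.cond h (Primrec.const 1) (Primrec.const 0)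

theorem eventually_stageValue (e x : ℕ) : ∀ᶠ t in atTop, stageValue e x t = setValue (e, x) := by
  by_cases h : ∃ t, EnumeratedBy e x t
  · obtain ⟨t, ht⟩ := h
    filter_upwards [eventually_ge_atTop t] with s hs
    have : ∃ t, EnumeratedBy e x t := ⟨t, ht⟩
    simp [stageValue, setValue, this, ht.mono hs]
  · have : ∀ t, ¬ EnumeratedBy e x t := fun t ht => h ⟨t, ht⟩
    exact Eventually.of_forall fun t => by simp [stageValue, setValue, this]

theorem computable_filter_range {α : Type*} [Primcodable α] {f : α → ℕ → Bool}
    (hf : Computable₂ f) : Computable₂ fun a n => (List.range n).filter (f a) := by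
  have h : Computable fun q : α × ℕ => (Nat.rec [] (fun m l =>
      l ++ bif f q.1 m then [m] else []) q.2 : List ℕ) := by
    refine Computable.nat_rec (h := fun (q : α × ℕ) (r : ℕ × List ℕ) =>
      r.2 ++ bif f q.1 r.1 then [r.1] else []) Computable.snd (Computable.const []) ?_
    have hm : Computable fun q : (α × ℕ) × ℕ × List ℕ => q.2.1 :=
      Computable.fst.comp Computable.snd
    exact (Computable.list_append.comp (Computable.snd.comp Computable.snd)
      (Computable.cond (hf.comp (Computable.fst.comp Computable.fst) hm)
        (Computable.list_cons.comp hm (Computable.const [])) (Computable.const []))).to₂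
  refine h.of_eq fun q => ?_
  dsimp only
  induction q.2 with
  | zero => rfl
  | succ n ih =>
    rw [List.range_succ, List.filter_append, ← ih]
    cases hn : f q.1 n <;> simp [hn]

/-- At stage `t`, the string `τ` looks extendible in the class given by `p`, and for each pair
`(k, x)` coded in `l`, all its extensions in that class that agree with it up to `k` compute the
value at `x` of the current approximation to the set with index `e`. -/
def Certifies (e : ℕ) (p : List (ℕ × ℕ × ℕ)) (τ : List Bool) (l : List ℕ) (t : ℕ) : Prop :=
  ¬ DeadAt p τ t ∧ ∀ m ∈ l, DeadAt ((e, m.unpair.2, stageValue e m.unpair.2 t) :: p)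
    (τ.take m.unpair.1) t

theorem primrec_exists_certifies (e : ℕ) (p : List (ℕ × ℕ × ℕ)) :
    PrimrecPred fun q : (ℕ × List ℕ) × ℕ => ∃ τ ∈ strings q.1.1, Certifies e p τ q.1.2 q.2 := by
  have h1 : PrimrecRel fun (m : ℕ) (a : List Bool × ℕ) =>
      DeadAt ((e, m.unpair.2, stageValue e m.unpair.2 a.2) :: p) (a.1.take m.unpair.1) a.2 := by
    have hm : Primrec fun q : ℕ × List Bool × ℕ => q.1.unpair := Primrec.unpair.comp Primrec.fst
    have hx : Primrec fun q : ℕ × List Bool × ℕ => q.1.unpair.2 := Primrec.snd.comp hm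
    have ht : Primrec fun q : ℕ × List Bool × ℕ => q.2.2 := Primrec.snd.comp Primrec.snd
    exact primrec_deadAt.comp (Primrec.pair (Primrec.pair
      (Primrec.list_cons.comp (Primrec.pair (Primrec.const e) (Primrec.pair hx
        ((primrec_stageValue e).comp hx ht))) (Primrec.const p))
      (Primrec.list_take.comp (Primrec.fst.comp hm) (Primrec.fst.comp Primrec.snd))) ht)
  have h2 : PrimrecRel fun (τ : List Bool) (a : List ℕ × ℕ) => Certifies e p τ a.1 a.2 := by
    refine PrimrecPred.and ?_ ?_
    · exact (primrec_deadAt.comp (Primrec.pair (Primrec.pair (Primrec.const p) Primrec.fst)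
        (Primrec.snd.comp Primrec.snd))).not
    · exact h1.forall_mem_list.comp (Primrec.fst.comp Primrec.snd)
        (Primrec.pair Primrec.fst (Primrec.snd.comp Primrec.snd))
  exact h2.exists_mem_list.comp (primrec_strings.comp (Primrec.fst.comp Primrec.fst))
    (Primrec.pair (Primrec.snd.comp Primrec.fst) Primrec.snd)

/-- Each extension of `τ` by `t` bits has a prefix extending `σ` by `t` bits, and violations persist
to longer strings. -/
theorem DeadAt.of_prefix {p : List (ℕ × ℕ × ℕ)} {σ τ : List Bool} {t : ℕ} (h : σ <+: τ)
    (hd : DeadAt p σ t) : DeadAt p τ t := by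
  intro ρ hρ hg
  rw [mem_strings] at hρ
  obtain ⟨ν, rfl⟩ := h
  refine hd ((ν ++ ρ).take t) (mem_strings.2 (by simp; omega)) (hg.of_prefix ?_)
  rw [List.append_assoc]
  exact (List.prefix_append_right_inj σ).2 (List.take_prefix t _)

section Obeys

variable {c : ℕ → ℕ → ℚ≥0} {Y : Set ℕ} {e k₀ : ℕ} {p : List (ℕ × ℕ × ℕ)}

/-- One can compute stages at which longer and longer initial segments of the set with index `e`
are certified by strings. -/
theorem exists_stages (hc : IsCostFunction c) (hY : InClass p Y)
    (hcert : ∀ k ≥ k₀, ∀ x s, Exceeds c k x s →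
      ∃ t, DeadAt ((e, x, setValue (e, x)) :: p) (initSeg Y k) t) :
    ∃ h : ℕ → ℕ, Computable h ∧ StrictMono h ∧ ∀ s, ∃ τ : List Bool, τ.length = s + 1 ∧
      ¬ DeadAt p τ (h s) ∧ ∀ k x, k₀ ≤ k → k ≤ s + 1 → x ≤ s + 1 → Exceeds c k x (s + 1) →
        DeadAt ((e, x, stageValue e x (h s)) :: p) (τ.take k) (h s) := by
  classical
  let test : ℕ → ℕ → Bool := fun s m => decide (k₀ ≤ m.unpair.1) && (decide (m.unpair.1 ≤ s + 1) &&
    decide (Exceeds c m.unpair.1 m.unpair.2 (s + 1)))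
  have htest : Computable₂ test := by
    have hk : Primrec fun q : ℕ × ℕ => q.2.unpair.1 :=
      Primrec.fst.comp (Primrec.unpair.comp Primrec.snd)
    have hs : Primrec fun q : ℕ × ℕ => q.1 + 1 := Primrec.succ.comp Primrec.fst
    have h1 : Primrec fun q : ℕ × ℕ => decide (k₀ ≤ q.2.unpair.1) :=
      (Primrec.nat_le.comp (Primrec.const k₀) hk).decide
    have h2 : Primrec fun q : ℕ × ℕ => decide (q.2.unpair.1 ≤ q.1 + 1) :=
      (Primrec.nat_le.comp hk hs).decide
    have h3 : Computable fun q : ℕ × ℕ =>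
        decide (Exceeds c q.2.unpair.1 q.2.unpair.2 (q.1 + 1)) :=
      Computable.comp (g := fun q : ℕ × ℕ => (q.2.unpair, q.1 + 1))
        (computablePred_exceeds hc).decide
        (Primrec.pair (Primrec.unpair.comp Primrec.snd) hs).to_comp
    have hand : Computable₂ and := Primrec.and.to_comp
    have h4 := hand.comp h1.to_comp (hand.comp h2.to_comp h3)
    exact h4
  -- All codes of pairs with both entries at most `s + 1` are below `(s + 2)²`.
  let l : ℕ → List ℕ := fun s => (List.range ((s + 2) * (s + 2))).filter (test s)
  have hl : Computable l := (computable_filter_range htest).comp Computable.id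
    (Primrec.nat_mul.comp (Primrec.succ.comp Primrec.succ)
      (Primrec.succ.comp Primrec.succ)).to_comp
  have hpred : ComputablePred fun q : (ℕ × ℕ) × ℕ => q.1.2 ≤ q.2 ∧
      ∃ τ ∈ strings (q.1.1 + 1), Certifies e p τ (l q.1.1) q.2 := by
    have h1 : Computable fun q : (ℕ × ℕ) × ℕ => decide (q.1.2 ≤ q.2) :=
      (Primrec.nat_le.comp (Primrec.snd.comp Primrec.fst) Primrec.snd).decide.to_comp
    obtain ⟨F, hF, hFeq⟩ :=
      ComputablePred.computable_iff.1 (primrec_exists_certifies e p).computablePred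
    have h2 : Computable fun q : (ℕ × ℕ) × ℕ => F ((q.1.1 + 1, l q.1.1), q.2) :=
      hF.comp (Computable.pair
        (Computable.pair (Computable.succ.comp (Computable.fst.comp Computable.fst))
          (hl.comp (Computable.fst.comp Computable.fst))) Computable.snd)
    refine ComputablePred.computable_iff.2 ⟨_, Primrec.and.to_comp.comp h1 h2, funext fun q => ?_⟩
    have := congrFun hFeq ((q.1.1 + 1, l q.1.1), q.2)
    dsimp only at this
    simp [this]
  -- The search halts because the initial segment of `Y` itself is eventually a certificate: it is
  -- live, and the finitely many values in question settle. The string found may well be a different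
  -- one.
  have hex : ∀ q : ℕ × ℕ, ∃ t, q.2 ≤ t ∧ ∃ τ ∈ strings (q.1 + 1), Certifies e p τ (l q.1) t := by
    rintro ⟨s, r⟩
    have hev : ∀ᶠ t in atTop, ∀ m ∈ (l s).toFinset,
        DeadAt ((e, m.unpair.2, stageValue e m.unpair.2 t) :: p)
          ((initSeg Y (s + 1)).take m.unpair.1) t := by
      rw [Filter.eventually_all_finset]
      intro m hm
      simp only [l, test, List.mem_toFinset, List.mem_filter, Bool.and_eq_true,
        decide_eq_true_eq] at hm
      obtain ⟨-, hk₀, hks, hx⟩ := hm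
      obtain ⟨t, ht⟩ := hcert _ hk₀ _ _ hx
      filter_upwards [eventually_ge_atTop t, eventually_stageValue e m.unpair.2] with u hu hv
      rw [hv, take_initSeg Y hks]
      exact ht.mono hu
    obtain ⟨t, hrt, ht⟩ := ((eventually_ge_atTop r).and hev).exists
    refine ⟨t, hrt, initSeg Y (s + 1), mem_strings.2 (length_initSeg _ _), hY.live _ t,
      fun m hm => ht m (List.mem_toFinset.2 hm)⟩
  have hnext := Computable.find hpred hex
  set next : ℕ × ℕ → ℕ := fun q => Nat.find (hex q) with hdef
  let h : ℕ → ℕ := fun s => Nat.rec (next (0, 0)) (fun s r => next (s + 1, r + 1)) s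
  have hspec : ∀ s, ∃ r, h s = next (s, r) := by
    rintro (_ | s)
    · exact ⟨0, rfl⟩
    · exact ⟨h s + 1, rfl⟩
  refine ⟨h, ?_, strictMono_nat_of_lt_succ fun s => (Nat.find_spec (hex (s + 1, h s + 1))).1,
    fun s => ?_⟩
  · refine Computable.nat_rec (h := fun (_ : ℕ) (q : ℕ × ℕ) => next (q.1 + 1, q.2 + 1))
      Computable.id (Computable.const (next (0, 0))) ?_
    exact (hnext.comp (Computable.pair
      (Computable.succ.comp (Computable.fst.comp Computable.snd))
      (Computable.succ.comp (Computable.snd.comp Computable.snd)))).to₂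
  · obtain ⟨r, hr⟩ := hspec s
    obtain ⟨-, τ, hτ, hlive, hτc⟩ := Nat.find_spec (hex (s, r))
    rw [hr]
    refine ⟨τ, mem_strings.1 hτ, hlive, fun k x hk₀ hks hxs hx => ?_⟩
    have := hτc (Nat.pair k x) ?_
    · simpa using this
    · have hle : Nat.pair k x < (s + 2) * (s + 2) :=
        (Nat.pair_lt_max_add_one_sq k x).trans_le ((Nat.pow_le_pow_left
          (Nat.succ_le_succ (max_le hks hxs)) 2).trans_eq (sq _))
      simp [l, test, hk₀, hks, hx, hle]

theorem ofReal_le_inv_pow {q : ℚ≥0} {k : ℕ} (h : q ≤ (4 ^ k)⁻¹) :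
    ENNReal.ofReal (q : ℝ) ≤ 4⁻¹ ^ k := by
  have h' : (q : ℝ) ≤ ((4 : ℝ) ^ k)⁻¹ := by
    have := NNRat.cast_mono (K := ℝ) h
    simpa using this
  refine (ENNReal.ofReal_le_ofReal h').trans_eq ?_
  rw [ENNReal.ofReal_inv_of_pos (by positivity), ENNReal.ofReal_pow (by norm_num),
    ENNReal.inv_pow]
  norm_num

/-- Grouped by length, the `2ⁿ` strings of length `n` contribute `4 · 2⁻ⁿ`. -/
theorem tsum_list_lt_top : ∑' σ : List Bool, 4 * (4⁻¹ : ℝ≥0∞) ^ σ.length < ∞ := by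
  rw [← (Equiv.sigmaFiberEquiv (List.length : List Bool → ℕ)).tsum_eq,
    ENNReal.tsum_sigma']
  have : ∀ n, ∑' σ : {σ : List Bool // σ.length = n}, 4 * (4⁻¹ : ℝ≥0∞) ^
      (Equiv.sigmaFiberEquiv (List.length : List Bool → ℕ) ⟨n, σ⟩).length = 4 * 2⁻¹ ^ n := by
    intro n
    have h1 : ∀ σ : {σ : List Bool // σ.length = n}, 4 * (4⁻¹ : ℝ≥0∞) ^
        (Equiv.sigmaFiberEquiv (List.length : List Bool → ℕ) ⟨n, σ⟩).length = 4 * 4⁻¹ ^ n := by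
      rintro ⟨σ, rfl⟩
      rfl
    let _ : Fintype {σ : List Bool // σ.length = n} :=
      inferInstanceAs (Fintype (List.Vector Bool n))
    have h2 : Fintype.card {σ : List Bool // σ.length = n} = 2 ^ n := by
      have := card_vector (α := Bool) n
      rw [Fintype.card_bool] at this
      exact this
    simp only [h1]
    rw [tsum_fintype, Finset.sum_const, Finset.card_univ, h2, nsmul_eq_mul, mul_left_comm]
    push_cast
    rw [← mul_pow]
    congr 2
    rw [show (4 : ℝ≥0∞) = 2 * 2 by norm_num, ENNReal.mul_inv (by simp) (by simp), ← mul_assoc,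
      ENNReal.mul_inv_cancel (by simp) (by simp), one_mul]
  simp only [this]
  rw [ENNReal.tsum_mul_left, ENNReal.tsum_geometric]
  exact ENNReal.mul_lt_top (by simp) (by simp)

end Obeys

/-! ### Bounding the total cost -/

theorem isComputableApprox_stages {A : Set ℕ} {e : ℕ} {h : ℕ → ℕ} (hcomp : Computable h)
    (hmono : StrictMono h) (hA : ∀ x, x ∈ A ↔ ∃ t, EnumeratedBy e x t) :
    ∃ As : ℕ → Finset ℕ, IsComputableApprox As A ∧
      ∀ s x, x ∈ As s ↔ x ≤ s ∧ EnumeratedBy e x (h s) := by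
  classical
  have hrel : PrimrecRel fun x t => EnumeratedBy e x t :=
    primrec_enumeratedBy.comp (f := fun q : ℕ × ℕ => ((e, q.1), q.2))
      (Primrec.pair (Primrec.pair (Primrec.const e) Primrec.fst) Primrec.snd)
  have hmem : ∀ s x, x ∈ ((List.range (s + 1)).filter fun x => EnumeratedBy e x (h s)).toFinset ↔
      x ≤ s ∧ EnumeratedBy e x (h s) := by
    intro s x
    simp
  refine ⟨fun s => ((List.range (s + 1)).filter fun x => EnumeratedBy e x (h s)).toFinset,
    ⟨⟨_, ?_, fun s => rfl⟩, fun x => ?_⟩, hmem⟩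
  · exact hrel.listFilter.to_comp.comp (Primrec.list_range.comp Primrec.succ).to_comp hcomp
  · simp only [hmem, hA]
    by_cases hx : ∃ t, EnumeratedBy e x t
    · obtain ⟨t, ht⟩ := hx
      filter_upwards [eventually_ge_atTop x, eventually_ge_atTop t] with s hxs hts
      exact ⟨fun h => ⟨_, h.2⟩, fun _ => ⟨hxs, ht.mono (hts.trans (hmono.le_apply))⟩⟩
    · exact Eventually.of_forall fun s => ⟨fun h => ⟨_, h.2⟩, fun h => absurd h hx⟩

theorem changeCost_eq {c : ℕ → ℕ → ℚ≥0} {As : ℕ → Finset ℕ} {e : ℕ} {h : ℕ → ℕ}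
    (hmono : StrictMono h) (hAs : ∀ s x, x ∈ As s ↔ x ≤ s ∧ EnumeratedBy e x (h s)) (s : ℕ) :
    changeCost c As (s + 1) = 0 ∨ ∃ x ≤ s, changeCost c As (s + 1) = c x (s + 1) ∧
      ¬ EnumeratedBy e x (h s) ∧ EnumeratedBy e x (h (s + 1)) := by
  classical
  unfold changeCost
  split_ifs with hex
  · right
    obtain ⟨hlt, hne⟩ := Nat.find_spec hex
    refine ⟨Nat.find hex, Nat.le_of_lt_succ hlt, rfl, ?_⟩
    have h1 := EnumeratedBy.mono (e := e) (x := Nat.find hex) (hmono.monotone (Nat.le_succ s))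
    generalize Nat.find hex = x at hlt hne h1 ⊢
    -- Only `x ≤ s` counts, so the truncation of `As` at the stage causes no change; a change must
    -- be an enumeration.
    rw [Nat.add_sub_cancel, hAs, hAs] at hne
    by_contra! hcon
    refine hne ⟨fun hh => ⟨by omega, h1 hh.2⟩, fun hh => ⟨by omega, ?_⟩⟩
    by_contra hn
    exact hcon hn hh.2
  · exact Or.inl rfl

/-- Each change is paid for in one of three ways: by the geometric series `4⁻ˢ` if it is cheap, by a
finite sum if a number below `b k₀` enters, and otherwise by the string certifying the old value. -/
theorem totalCost_lt_top {c : ℕ → ℕ → ℚ≥0} (hmon : IsMonotonic c) {b : ℕ → ℕ}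
    (hb : ∀ k x s, Exceeds c k x s → x < b k) {e k₀ : ℕ} {p : List (ℕ × ℕ × ℕ)}
    (he : MonotoneFunctional e) {h : ℕ → ℕ} (hmono : StrictMono h)
    (hcert : ∀ s, ∃ τ : List Bool, τ.length = s + 1 ∧ ¬ DeadAt p τ (h s) ∧
      ∀ k x, k₀ ≤ k → k ≤ s + 1 → x ≤ s + 1 → Exceeds c k x (s + 1) →
        DeadAt ((e, x, stageValue e x (h s)) :: p) (τ.take k) (h s))
    {As : ℕ → Finset ℕ} (hAs : ∀ s x, x ∈ As s ↔ x ≤ s ∧ EnumeratedBy e x (h s)) :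
    totalCost c As < ∞ := by
  classical
  choose τ hlen hlive hτ using hcert
  have hchange : ∀ s, ∃ x, changeCost c As (s + 1) = 0 ∨ (x ≤ s ∧
      changeCost c As (s + 1) = c x (s + 1) ∧ ¬ EnumeratedBy e x (h s) ∧
      EnumeratedBy e x (h (s + 1))) := by
    intro s
    rcases changeCost_eq (c := c) hmono hAs s with h0 | ⟨x, hx⟩
    · exact ⟨0, Or.inl h0⟩
    · exact ⟨x, Or.inr hx⟩
  choose x hx using hchange
  let D : Set ℕ := {s | ¬ EnumeratedBy e (x s) (h s) ∧ EnumeratedBy e (x s) (h (s + 1)) ∧ x s ≤ s}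
  have hentered : ∀ {s u}, s ∈ D → s < u → EnumeratedBy e (x s) (h u) := fun hs hsu =>
    hs.2.1.mono (hmono.monotone hsu)
  -- The finitely many stages at which a number less than `b k₀` enters.
  let F : Set ℕ := {s | s ∈ D ∧ x s < b k₀}
  have hF : F.Finite := by
    refine Set.Finite.of_injOn (f := x) (t := Set.Iio (b k₀)) (fun s hs => hs.2) ?_
      (Set.finite_Iio _)
    intro s hs u hu hsu
    by_contra hne
    rcases lt_or_gt_of_ne hne with hlt | hlt
    · exact hu.1.1 (hsu ▸ hentered hs.1 hlt)
    · exact hs.1.1 (hsu ▸ hentered hu.1 hlt)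
  -- The stages at which the cost is between two successive thresholds.
  let B : Set ℕ := {s | s ∈ D ∧ ∃ k, k₀ < k ∧ k ≤ s + 1 ∧ Exceeds c k (x s) (s + 1) ∧
    ¬ Exceeds c (k - 1) (x s) (s + 1)}
  have hBk : ∀ s : B, ∃ k, k₀ < k ∧ k ≤ s + 1 ∧ Exceeds c k (x s) (s + 1) ∧
    ¬ Exceeds c (k - 1) (x s) (s + 1) := fun s => s.2.2
  choose k hk₀ hks hex hnex using hBk
  -- The string charged for the change; its length recovers `k s`.
  let ρ : B → List Bool := fun s => (τ s).take (k s)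
  have hρlen : ∀ s, (ρ s).length = k s := fun s => by
    simp only [ρ, List.length_take, hlen]
    exact min_eq_left (hks s)
  have hρne : ∀ s u : B, (s : ℕ) < u → ρ s ≠ ρ u := by
    intro s u hsu heq
    have hkk : k s = k u := by rw [← hρlen s, ← hρlen u, heq]
    -- At stage `s` the common string certifies the value 0 at `x s`. The cost of `x s` still
    -- exceeds the threshold at `u`, so there the same string certifies the value 1. It would then
    -- be dead for `p`, although `τ u` extends it and is not dead at that stage.
    have h0 := hτ s (k s) (x s) (hk₀ s).le (hks s) (s.2.1.2.2.trans (Nat.le_succ _)) (hex s)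
    have h1 := hτ u (k s) (x s) (hk₀ s).le (by rw [hkk]; exact hks u)
      (s.2.1.2.2.trans (by omega))
      (lt_of_lt_of_le (hex s) (cost_mono hmon.2 _ (by omega)))
    have hv0 : stageValue e (x s) (h s) = 0 := by simp [stageValue, s.2.1.1]
    have hv1 : stageValue e (x s) (h u) = 1 := by simp [stageValue, hentered s.2.1 hsu]
    rw [hv0] at h0
    rw [hv1] at h1
    have heq' : (τ s).take (k s) = (τ u).take (k s) := by
      conv_rhs => rw [hkk]
      exact heq
    rw [heq'] at h0
    exact hlive u (((h0.mono (hmono.monotone hsu.le)).of_two_values he zero_ne_one h1).of_prefix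
      (List.take_prefix _ _))
  have hρ : Function.Injective ρ := by
    intro s u heq
    by_contra hne
    rcases lt_or_gt_of_ne (fun hh => hne (Subtype.ext hh)) with hlt | hlt
    · exact hρne s u hlt heq
    · exact hρne u s hlt heq.symm
  let cost : ℕ → ℝ≥0∞ := fun s => ENNReal.ofReal (changeCost c As (s + 1) : ℝ)
  have hbound : ∀ s, cost s ≤ 4⁻¹ ^ s + (F.indicator cost s + B.indicator cost s) := by
    intro s
    rcases hx s with h0 | ⟨hxs, hcs, hn, hy⟩
    · simp [cost, h0]
    have hD : s ∈ D := ⟨hn, hy, hxs⟩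
    by_cases hsF : s ∈ F
    · rw [Set.indicator_of_mem hsF, add_left_comm]
      exact le_self_add
    by_cases hsB : s ∈ B
    · rw [Set.indicator_of_mem hsB, ← add_assoc]
      exact le_add_self
    refine le_trans (ofReal_le_inv_pow (k := s) ?_) le_self_add
    rw [hcs]
    by_contra! hgt
    have hk : ∃ k, Exceeds c k (x s) (s + 1) := ⟨s, hgt⟩
    have hle : Nat.find hk ≤ s := Nat.find_min' hk hgt
    -- The least `k` whose threshold is exceeded either is above `k₀`, so that the cost lies between
    -- successive thresholds, or shows that the cost exceeds `4⁻ᵏ⁰` with `k₀` as exponent, so that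
    -- the number is below `b k₀`.
    by_cases hlt : k₀ < Nat.find hk
    · exact hsB ⟨hD, Nat.find hk, hlt, by omega, Nat.find_spec hk, Nat.find_min hk (by omega)⟩
    · refine hsF ⟨hD, hb k₀ (x s) (s + 1) (lt_of_le_of_lt ?_ (Nat.find_spec hk))⟩
      exact inv_anti₀ (by positivity) (pow_le_pow_right₀ (by norm_num) (not_lt.1 hlt))
  have hsumF : ∑' s, F.indicator cost s < ∞ := by
    rw [tsum_eq_sum (s := hF.toFinset) fun s hs =>
      Set.indicator_of_notMem (by simpa using hs) _]
    refine ENNReal.sum_lt_top.2 fun s _ => ?_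
    exact lt_of_le_of_lt (Set.indicator_le_self' (fun _ _ => zero_le) s) ENNReal.ofReal_lt_top
  have hsumB : ∑' s, B.indicator cost s < ∞ := by
    rw [← tsum_subtype B cost]
    refine lt_of_le_of_lt ((ENNReal.tsum_le_tsum fun s => ?_).trans
      (ENNReal.tsum_comp_le_tsum_of_injective hρ fun σ => 4 * (4⁻¹ : ℝ≥0∞) ^ σ.length))
      tsum_list_lt_top
    rcases hx s with h0 | ⟨-, hcs, -, -⟩
    · simp [cost, h0]
    have hle : changeCost c As (s + 1) ≤ (4 ^ (k s - 1))⁻¹ := hcs ▸ not_lt.1 (hnex s)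
    refine (ofReal_le_inv_pow hle).trans_eq ?_
    obtain ⟨m, hm⟩ : ∃ m, k s = m + 1 := ⟨k s - 1, by have := hk₀ s; omega⟩
    rw [hρlen, hm, Nat.add_sub_cancel, pow_succ', ← mul_assoc,
      ENNReal.mul_inv_cancel (by simp) (by simp), one_mul]
  refine lt_of_le_of_lt (ENNReal.tsum_le_tsum hbound) ?_
  rw [ENNReal.tsum_add, ENNReal.tsum_add, ENNReal.tsum_geometric]
  refine ENNReal.add_lt_top.2 ⟨?_, ENNReal.add_lt_top.2 ⟨hsumF, hsumB⟩⟩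
  rw [ENNReal.inv_lt_top, tsub_pos_iff_lt]
  exact ENNReal.inv_lt_one.2 (by norm_num)

end CostBasis

theorem mainTheorem8 (P : Set (Set ℕ)) (hP : IsPi01Class P) (hne : P.Nonempty)
    (c : ℕ → ℕ → ℚ≥0) (hc : IsCostFunction c) (hmon : IsMonotonic c) (hlim : LimitCondition c) :
    ∃ Y ∈ P, IsDelta02 Y ∧
      ∀ A : Set ℕ, REPred (fun n => n ∈ A) → SetTuringReducible A Y → Obeys A c := by
  obtain ⟨base, hbase⟩ := CostBasis.exists_base hP
  obtain ⟨b, hb, hbx⟩ := CostBasis.exists_limitComputable_bound hc hmon hlim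
  obtain ⟨Z, hZ⟩ := hne
  -- Any member `Z` of the class shows that the empty string is live, so that the construction can
  -- start.
  obtain ⟨Y, hYd, hYP, hY⟩ := CostBasis.exists_delta02_forcing hb (((hbase Z).1 hZ).live 0)
  refine ⟨Y, (hbase Y).2 hYP, hYd, fun A hA hAY => ?_⟩
  obtain ⟨e, hmono, hAe, he⟩ := CostBasis.exists_index hA hAY
  obtain ⟨p, k₀, hYp, hcert⟩ := hY e he
  obtain ⟨h, hcomp, hstrict, hτ⟩ := CostBasis.exists_stages hc hYp
    fun k hk x s hx => hcert k hk x (hbx k x s hx)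
  obtain ⟨As, hAs, hmem⟩ := CostBasis.isComputableApprox_stages hcomp hstrict hAe
  exact ⟨As, hAs, CostBasis.totalCost_lt_top hmon hbx hmono hstrict hτ hmem⟩
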